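/- Let $\tilde A$ be an abelian group, $A\subseteq\tilde A$ a subgroup, and let $V$ be a strongly $A$-graded Möbius or conformal vertex algebra. By a generalized $V$-module we mean a strongly $\tilde A$-graded one: $W=\coprod_{n\in\mathbb C,\ \beta\in\tilde A}W^{(\beta)}_{[n]}$, where $W_{[n]}$ is the generalized $n$-eigenspace of $L(0)$, $\dim W^{(\beta)}_{[n]}<\infty$, and for fixed $\beta,n$ one has $W^{(\beta)}_{[n+k]}=0$ for $k\in\mathbb Z$ sufficiently negative; maps of generalized modules commute with the vertex operators and the $\mathfrak{sl}(2)$-action and preserve the $\tilde A$-grading. Write $\overline W=\prod_{n\in\mathbb C}W_{[n]}$, let $Y^o(v,x)=Y(e^{xL(1)}(-x^{-2})^{L(0)}v,x^{-1})$ be the opposite vertex operator, and let $W'=\coprod (W^{(\beta)}_{[n]})^*$ be the contragredient module, with $\langle Y'(v,x)w',w\rangle=\langle w',Y^o(v,x)w\rangle$, $\langle L'(j)w',w\rangle=\langle w',L(-j)w\rangle$ for $j=-1,0,1$, and $(W')^{(\beta)}$ the set of $w'\in W'$ vanishing on $W^{(\gamma)}$ for $\gamma\neq-\beta$. Let $\mathcal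 C$ be a full subcategory, closed under isomorphisms, of the category of generalized $V$-modules or of its full subcategory of ordinary $V$-modules (those on which $L(0)$ is semisimple), closed under contragredients and under finite direct sums. Let $z\in\mathbb C^\times$ and let $W_1,W_2$ be objects of $\mathcal C$. A $Q(z)$-intertwining map of type $\binom{W}{W_1\,W_2}$ is a linear map $I:W_1\otimes W_2\to\overline W$ such that: $I(W_1^{(\beta)}\otimes W_2^{(\gamma)})\subseteq\overline{W^{(\beta+\gamma)}}$; for all $w_1\in W_1$, $w_2\in W_2$ and $n\in\mathbb C$ the component of $I(w_1\otimes w_2)$ of weight $n-m$ vanishes for $m\in\mathbb N$ sufficiently large; $$z^{-1}\delta\Big(\tfrac{x_1-x_0}{z}\Big)Y_W^o(v,x_0)I(w_1\otimes w_2)=x_0^{-1}\delta\Big(\tfrac{x_1-z}{x_0}\Big)I(Y_1^o(v,x_1)w_1\otimes w_2)-x_0^{-1}\delta\Big(\tfrac{z-x_1}{-x_0}\Big)I(w_1\otimes Y_2(v,x_1)w_2)$$ for $v\in V$ (where $\delta(x)=\sum_{n\in\mathbb Z}x^n$ and binomials are expanded in nonnegative powers of the second variable); and for $j=-1,0,1$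 $$L(-j)I(w_1\otimes w_2)=\sum_{i=0}^{j+1}\binom{j+1}{i}(-z)^i\big(I(L(i-j)w_1\otimes w_2)-I(w_1\otimes L(j-i)w_2)\big).$$ A $Q(z)$-product of $W_1$ and $W_2$ is a pair $(W;I)$ of a generalized module $W$ and such an $I$. A $Q(z)$-tensor product of $W_1$ and $W_2$ in $\mathcal C$ is a $Q(z)$-product $(W_0;I_0)$ with $W_0\in\mathcal C$ such that for every $Q(z)$-product $(W;I)$ with $W\in\mathcal C$ there is a unique map $\eta:W_0\to W$ with $I=\overline\eta\circ I_0$, where $\overline\eta:\overline{W_0}\to\overline W$ is the natural extension. Let $V$ and $\mathfrak{sl}(2)$ act on $(W_1\otimes W_2)^*$ by $$(Y'_{Q(z)}(v,x_0)\lambda)(w_1\otimes w_2)=\lambda(Y_1^o(v,x_0+z)w_1\otimes w_2)-\mathrm{Res}_{x_1}x_0^{-1}\delta\Big(\tfrac{z-x_1}{-x_0}\Big)\lambda(w_1\otimes Y_2(v,x_1)w_2),$$ $$(L'_{Q(z)}(j)\lambda)(w_1\otimes w_2)=\sum_{i=0}^{j+1}\binom{j+1}{i}(-z)^i\big(\lambda(L(i-j)w_1\otimes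 w_2)-\lambda(w_1\otimes L(j-i)w_2)\big),\qquad j=-1,0,1,$$ and let $((W_1\otimes W_2)^*)^{(\beta)}$ consist of the functionals vanishing on $(W_1\otimes W_2)^{(\gamma)}$ for all $\gamma\ne-\beta$. Define (the boxed-backslash product) $W_1\mathbin{\square}_{Q(z)}W_2\subseteq(W_1\otimes W_2)^*$ to be the union, over all $Q(z)$-products $(W;I)$ of $W_1$ and $W_2$ with $W\in\mathcal C$, of the images of the maps $I':W'\to(W_1\otimes W_2)^*$, $I'(w')=\langle w',I(\cdot)\rangle$. Then $W_1\mathbin{\square}_{Q(z)}W_2$ is a linear subspace of $(W_1\otimes W_2)^*$, and the following hold. (1) If $W_1\mathbin{\square}_{Q(z)}W_2$, with the restricted actions $Y'_{Q(z)}$, $L'_{Q(z)}$ and the restricted $\tilde A$-grading, is an object of $\mathcal C$, then its contragredient $(W_1\mathbin{\square}_{Q(z)}W_2)'$ together with the map $I_0:W_1\otimes W_2\to\overline{(W_1\mathbin{\square}_{Q(z)}W_2)'}$ determined by $\langle\lambda,I_0(w_1\otimes w_2)\rangle=\lambda(w_1\otimes w_2)$ for $\lambda\in W_1\mathbin{\square}_{Q(z)}W_2$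 is a $Q(z)$-tensor product of $W_1$ and $W_2$ in $\mathcal C$. (2) Conversely, suppose that $\mathcal C$ is closed under images, that is, for every object $M$ of $\mathcal C$, every generalized $V$-module $N$ and every map $\phi:M\to N$, the image $\phi(M)$ is an object of $\mathcal C$. If a $Q(z)$-tensor product of $W_1$ and $W_2$ in $\mathcal C$ exists, then $W_1\mathbin{\square}_{Q(z)}W_2$ (with the same structure) is an object of $\mathcal C$. -/

import Mathlib

open scoped TensorProduct

noncomputable section

namespace VTC

universe u w

/-! ## Formal calculus helpers -/

/-- The binomial coefficient `n (n - 1) ⋯ (n - i + 1) / i!` for an arbitrary integer `n`. -/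
def binom (n : ℤ) (i : ℕ) : ℂ := ((Ring.choose n i : ℤ) : ℂ)

/-- The sum of a family of linear maps that is locally finite (only finitely many of the maps are
nonzero on any given vector). -/
def locFinSum {ι M N : Type*} [AddCommGroup M] [Module ℂ M] [AddCommGroup N] [Module ℂ N]
    (T : ι → M →ₗ[ℂ] N) (hT : ∀ x, (Function.support fun i => T i x).Finite) : M →ₗ[ℂ] N where
  toFun x := ∑ᶠ i, T i x
  map_add' x y := by
    simp only [map_add]
    exact finsum_add_distrib (hT x) (hT y)
  map_smul' c x := by
    simp only [map_smul, RingHom.id_apply]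
    exact (smul_finsum' c (hT x)).symm

section Axioms

variable {V : Type*} [AddCommGroup V] [Module ℂ V] {W : Type*} [AddCommGroup W] [Module ℂ W]

/-- Lower truncation: `v_n w = 0` for `n` sufficiently large. Throughout, a vertex operator map
`Y(v, x) = ∑ v_n x^{-n-1}` is given by its modes, `Y v n = v_n`. -/
def LowerTruncated (Y : V →ₗ[ℂ] ℤ → Module.End ℂ W) : Prop :=
  ∀ v w, ∃ N : ℤ, ∀ n, N ≤ n → Y v n w = 0

/-- `Y(𝟏, x) = 1`. -/
def VacuumAxiom (vac : V) (Y : V →ₗ[ℂ] ℤ → Module.End ℂ W) : Prop :=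
  ∀ n : ℤ, Y vac n = if n = -1 then 1 else 0

/-- The Jacobi identity
`x₀⁻¹ δ((x₁-x₂)/x₀) Y(a,x₁)Y(b,x₂) - x₀⁻¹ δ((x₂-x₁)/(-x₀)) Y(b,x₂)Y(a,x₁)`
`  = x₂⁻¹ δ((x₁-x₀)/x₂) Y(Y(a,x₀)b, x₂)`:
equality of the coefficients of `x₀^{-l-1} x₁^{-m-1} x₂^{-n-1}`, where every binomial is expanded
in nonnegative powers of its second variable. -/
def JacobiIdentity (YV : V →ₗ[ℂ] ℤ → Module.End ℂ V) (Y : V →ₗ[ℂ] ℤ → Module.End ℂ W) : Prop :=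
  ∀ (a b : V) (x : W) (l m n : ℤ),
    (∑ᶠ i : ℕ, ((-1 : ℂ) ^ i * binom l i) •
        (Y a (m + l - i) (Y b (n + i) x) - ((-1 : ℂ) ^ l) • Y b (n + l - i) (Y a (m + i) x)))
      = ∑ᶠ i : ℕ, binom m i • Y (YV a (l + i) b) (m + n - i) x

/-- `L j` for `j = -1, 0, 1` (indexed by `SignType = {-1, 0, 1}`) is a representation of `𝔰𝔩(2)`
with `[L(0), L(-1)] = L(-1)`, `[L(0), L(1)] = -L(1)`, `[L(-1), L(1)] = -2 L(0)`. -/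
def Sl2Relations (L : SignType → Module.End ℂ W) : Prop :=
  ⁅L 0, L (-1)⁆ = L (-1) ∧ ⁅L 0, L 1⁆ = -L 1 ∧ ⁅L (-1), L 1⁆ = (-2 : ℂ) • L 0

/-- The operator `L(j)` for an integer `j`; it is only ever used for `j ∈ {-1, 0, 1}`, where
`SignType.sign j` is `j` itself. -/
def Lop (L : SignType → Module.End ℂ W) (j : ℤ) : Module.End ℂ W := L (SignType.sign j)

/-- `[L(j), Y(v,x)] = ∑_{k=0}^{j+1} (j+1 choose k) x^{j+1-k} Y(L(k-1)v, x)`, `j = -1, 0, 1`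
(coefficient of `x^{-n-1}`). -/
def Sl2Bracket (LV : SignType → Module.End ℂ V) (Y : V →ₗ[ℂ] ℤ → Module.End ℂ W)
    (L : SignType → Module.End ℂ W) : Prop :=
  ∀ (j : SignType) (v : V) (n : ℤ),
    ⁅L j, Y v n⁆ = ∑ k ∈ Finset.range ((j : ℤ) + 2).toNat,
      binom ((j : ℤ) + 1) k • Y (Lop LV ((k : ℤ) - 1) v) (n + (j : ℤ) + 1 - k)

/-- `d/dx Y(v,x) = Y(L(-1)v, x)`. -/
def DerivativeProperty (LV : SignType → Module.End ℂ V) (Y : V →ₗ[ℂ] ℤ → Module.End ℂ W) : Prop :=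
  ∀ (v : V) (n : ℤ), Y (LV (-1) v) n = (-(n : ℂ)) • Y v (n - 1)

/-- The modes `L(n) = ω_{n+1}` satisfy the Virasoro relations with central charge `c`, and
the `𝔰𝔩(2)`-action is the one given by `L(-1), L(0), L(1)`. -/
def VirasoroProperty (ω : V) (c : ℂ) (Y : V →ₗ[ℂ] ℤ → Module.End ℂ W)
    (L : SignType → Module.End ℂ W) : Prop :=
  (∀ m n : ℤ, ⁅Y ω (m + 1), Y ω (n + 1)⁆ =
      ((m : ℂ) - n) • Y ω (m + n + 1) +
        (if m + n = 0 then (((m : ℂ) ^ 3 - m) / 12 * c) • (1 : Module.End ℂ W) else 0)) ∧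
    ∀ j : SignType, L j = Y ω ((j : ℤ) + 1)

end Axioms

/-! ## Strongly graded vertex algebras -/

/-- A strongly `A`-graded Möbius or conformal vertex algebra structure on `V`.  If `conf = none`
it is a Möbius vertex algebra; if `conf = some (ω, c)` it is a conformal vertex algebra with
conformal vector `ω` and central charge `c`.  The weight space `V_(n)`, `n ∈ ℤ`, is the
`n`-eigenspace of `L(0)`. -/
structure StronglyGradedVertexAlgebra (A : Type*) [AddCommGroup A] (V : Type*) [AddCommGroup V]
    [Module ℂ V] where
  /-- `Y v n = v_n` -/
  Y : V →ₗ[ℂ] ℤ → Module.End ℂ V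
  /-- the vacuum vector -/
  vac : V
  /-- the action of `𝔰𝔩(2)` -/
  L : SignType → Module.End ℂ V
  /-- conformal vector and central charge, in the conformal case -/
  conf : Option (V × ℂ)
  /-- the homogeneous subspace `V^(α)` -/
  gr : A → Submodule ℂ V
  lowerTruncated : LowerTruncated Y
  vacuum : VacuumAxiom vac Y
  creation : ∀ (v : V) (n : ℕ), Y v n vac = 0
  creation_limit : ∀ v : V, Y v (-1) vac = v
  jacobi : JacobiIdentity Y Y
  sl2 : Sl2Relations L
  sl2_bracket : Sl2Bracket L Y L
  derivative : DerivativeProperty L Y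
  weight_top : ⨆ n : ℤ, (L 0).eigenspace (n : ℂ) = ⊤
  gr_indep : iSupIndep gr
  gr_top : ⨆ α, gr α = ⊤
  gr_compatible : ∀ α, gr α = ⨆ n : ℤ, gr α ⊓ (L 0).eigenspace (n : ℂ)
  gr_truncated : ∀ α, ∃ N : ℤ, ∀ n, n ≤ N → gr α ⊓ (L 0).eigenspace (n : ℂ) = ⊥
  gr_finite : ∀ α (n : ℤ), FiniteDimensional ℂ ↥(gr α ⊓ (L 0).eigenspace (n : ℂ))
  vac_mem : vac ∈ gr 0 ⊓ (L 0).eigenspace 0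
  Y_mem : ∀ α β, ∀ v ∈ gr α, ∀ u ∈ gr β, ∀ n, Y v n u ∈ gr (α + β)
  L_mem : ∀ j α, ∀ v ∈ gr α, L j v ∈ gr α
  conformal : ∀ ω c, conf = some (ω, c) →
    ω ∈ gr 0 ⊓ (L 0).eigenspace 2 ∧ VirasoroProperty ω c Y L

namespace StronglyGradedVertexAlgebra

variable {A : Type*} [AddCommGroup A] {V : Type*} [AddCommGroup V] [Module ℂ V]
  (𝒱 : StronglyGradedVertexAlgebra A V)

/-- The weight space `V_(n)`. -/
def wt (n : ℤ) : Submodule ℂ V := (𝒱.L 0).eigenspace (n : ℂ)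

theorem wt_internal : DirectSum.IsInternal 𝒱.wt := by
  apply DirectSum.isInternal_submodule_of_iSupIndep_of_iSup_eq_top
  · exact ((𝒱.L 0).eigenspaces_iSupIndep).comp (f := fun n : ℤ => (n : ℂ)) Int.cast_injective
  · exact 𝒱.weight_top

/-- The projection of `V` onto its weight space `V_(h)`. -/
def proj (h : ℤ) : V →ₗ[ℂ] V :=
  (𝒱.wt h).subtype ∘ₗ DirectSum.component ℂ ℤ (fun n => 𝒱.wt n) h ∘ₗ
    (LinearEquiv.ofBijective (DirectSum.coeLinearMap 𝒱.wt) 𝒱.wt_internal).symm.toLinearMap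

theorem proj_finite (v : V) : {h : ℤ | 𝒱.proj h v ≠ 0}.Finite := by
  classical
  set d := (LinearEquiv.ofBijective (DirectSum.coeLinearMap 𝒱.wt) 𝒱.wt_internal).symm v with hd
  refine (DFinsupp.support d).finite_toSet.subset ?_
  intro h hh
  simp only [Finset.mem_coe, DFinsupp.mem_support_toFun]
  intro h0
  apply hh
  change ((d h : 𝒱.wt h) : V) = 0
  rw [h0]; rfl

theorem proj_of_mem {h : ℤ} {v : V} (hv : v ∈ 𝒱.wt h) (k : ℤ) :
    𝒱.proj k v = if k = h then v else 0 := by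
  classical
  have : (LinearEquiv.ofBijective (DirectSum.coeLinearMap 𝒱.wt) 𝒱.wt_internal).symm v
      = DirectSum.lof ℂ ℤ (fun n => 𝒱.wt n) h ⟨v, hv⟩ := by
    rw [LinearEquiv.symm_apply_eq]
    exact (DirectSum.coeLinearMap_lof 𝒱.wt h ⟨v, hv⟩).symm
  change ((((LinearEquiv.ofBijective (DirectSum.coeLinearMap 𝒱.wt) 𝒱.wt_internal).symm v) k :
    𝒱.wt k) : V) = _
  rw [this]
  split_ifs with hk
  · subst hk
    rw [DirectSum.lof_apply]
  · rw [DirectSum.lof_eq_of, DirectSum.of_eq_of_ne _ _ _ hk]; rfl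

theorem L1_mem_wt {n : ℤ} {v : V} (hv : v ∈ 𝒱.wt n) : 𝒱.L 1 v ∈ 𝒱.wt (n - 1) := by
  have h := LinearMap.congr_fun 𝒱.sl2.2.1 v
  rw [wt, Module.End.mem_eigenspace_iff] at hv ⊢
  simp only [Ring.lie_def, LinearMap.sub_apply, Module.End.mul_apply,
    LinearMap.neg_apply, hv, map_smul] at h
  push_cast
  rw [sub_smul, one_smul]
  rw [sub_eq_iff_eq_add.1 h]
  abel

theorem L1_pow_mem {α : A} {n : ℤ} {v : V} (hv : v ∈ 𝒱.gr α ⊓ 𝒱.wt n) (m : ℕ) :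
    (𝒱.L 1 ^ m) v ∈ 𝒱.gr α ⊓ 𝒱.wt (n - m) := by
  induction m with
  | zero => simpa using hv
  | succ m ih =>
    rw [pow_succ', Module.End.mul_apply]
    refine ⟨𝒱.L_mem 1 α _ ih.1, ?_⟩
    have := 𝒱.L1_mem_wt ih.2
    have e : n - (m : ℤ) - 1 = n - ((m + 1 : ℕ) : ℤ) := by push_cast; ring
    rwa [e] at this

/-- Induction over doubly homogeneous vectors. -/
theorem homogeneous_induction {P : V → Prop}
    (hom : ∀ α n, ∀ v ∈ 𝒱.gr α ⊓ 𝒱.wt n, P v) (zero : P 0)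
    (add : ∀ x y, P x → P y → P (x + y)) (v : V) : P v := by
  have hv : v ∈ ⨆ α, 𝒱.gr α := by rw [𝒱.gr_top]; trivial
  refine Submodule.iSup_induction _ (motive := P) hv (fun α x hx => ?_) zero add
  rw [𝒱.gr_compatible α] at hx
  exact Submodule.iSup_induction _ (motive := P) hx (fun n y hy => hom α n y hy) zero add

theorem L1_nilpotent (v : V) : ∃ M : ℕ, ∀ m, M ≤ m → (𝒱.L 1 ^ m) v = 0 := by
  refine 𝒱.homogeneous_induction (P := fun v => ∃ M : ℕ, ∀ m, M ≤ m → (𝒱.L 1 ^ m) v = 0)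
    (fun α n v hv => ?_) ⟨0, fun m _ => map_zero _⟩ ?_ v
  · obtain ⟨N, hN⟩ := 𝒱.gr_truncated α
    refine ⟨(n - N).toNat, fun m hm => ?_⟩
    have h1 := 𝒱.L1_pow_mem hv m
    have h2 : 𝒱.gr α ⊓ 𝒱.wt (n - m) = ⊥ := hN _ (by omega)
    rw [h2] at h1
    exact (Submodule.mem_bot ℂ).1 h1
  · rintro x y ⟨M, hM⟩ ⟨N, hN⟩
    refine ⟨max M N, fun m hm => ?_⟩
    rw [map_add, hM m (le_trans (le_max_left _ _) hm), hN m (le_trans (le_max_right _ _) hm),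
      add_zero]

variable {W : Type*} [AddCommGroup W] [Module ℂ W]

/-- The `(h, m)` summand of the mode `v^o_n` of the opposite vertex operator. -/
def oppTerm (Y : V →ₗ[ℂ] ℤ → Module.End ℂ W) (n : ℤ) (p : ℤ × ℕ) : V →ₗ[ℂ] Module.End ℂ W :=
  ((-1 : ℂ) ^ p.1 * ((p.2.factorial : ℂ))⁻¹) •
    (LinearMap.proj (-n - p.2 - 2 + 2 * p.1) ∘ₗ Y ∘ₗ (𝒱.L 1 ^ p.2) ∘ₗ 𝒱.proj p.1)

theorem oppTerm_finite (Y : V →ₗ[ℂ] ℤ → Module.End ℂ W) (v : V) :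
    ∃ s : Set (ℤ × ℕ), s.Finite ∧ ∀ n p, p ∉ s → 𝒱.oppTerm Y n p v = 0 := by
  choose M hM using fun h : ℤ => 𝒱.L1_nilpotent (𝒱.proj h v)
  refine ⟨⋃ h ∈ {h : ℤ | 𝒱.proj h v ≠ 0}, (fun m : ℕ => (h, m)) '' (Set.Iio (M h)),
    (𝒱.proj_finite v).biUnion fun h _ => (Set.finite_Iio _).image _, ?_⟩
  rintro n ⟨h, m⟩ hp
  by_cases h0 : 𝒱.proj h v = 0
  · simp [oppTerm, h0]
  · by_cases hm : m < M h
    · exact absurd (Set.mem_biUnion (show h ∈ {h : ℤ | 𝒱.proj h v ≠ 0} from h0)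
        (Set.mem_image_of_mem (fun m : ℕ => (h, m)) (Set.mem_Iio.2 hm))) hp
    · simp [oppTerm, hM h m (not_lt.1 hm)]

/-- The opposite vertex operator
`Y^o(v,x) = Y(e^{x L(1)} (-x^{-2})^{L(0)} v, x^{-1}) = ∑ v^o_n x^{-n-1}`, given by its modes
`opp Y v n = v^o_n`; for `v` of weight `h`,
`v^o_n = (-1)^h ∑_{m ≥ 0} (1/m!) (L(1)^m v)_{-n-m-2+2h}`. -/
def opp (Y : V →ₗ[ℂ] ℤ → Module.End ℂ W) : V →ₗ[ℂ] ℤ → Module.End ℂ W :=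
  LinearMap.pi fun n => locFinSum (𝒱.oppTerm Y n) fun v => by
    obtain ⟨s, hs, h⟩ := 𝒱.oppTerm_finite Y v
    exact hs.subset fun p hp => by
      by_contra hps
      exact hp (h n p hps)

theorem opp_apply (Y : V →ₗ[ℂ] ℤ → Module.End ℂ W) (v : V) (n : ℤ) :
    𝒱.opp Y v n = ∑ᶠ p : ℤ × ℕ, 𝒱.oppTerm Y n p v := rfl

/-- `v^o_n w = 0` for `n` sufficiently negative. -/
theorem opp_truncated {Y : V →ₗ[ℂ] ℤ → Module.End ℂ W} (hY : LowerTruncated Y) (v : V) (w : W) :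
    ∃ N : ℤ, ∀ n, n ≤ N → 𝒱.opp Y v n w = 0 := by
  obtain ⟨s, hs, h⟩ := 𝒱.oppTerm_finite Y v
  choose N hN using fun p : ℤ × ℕ => hY ((𝒱.L 1 ^ p.2) (𝒱.proj p.1 v)) w
  obtain ⟨B, hB⟩ := (hs.image fun p : ℤ × ℕ => (-(N p) - p.2 - 2 + 2 * p.1 : ℤ)).bddBelow
  refine ⟨B, fun n hn => ?_⟩
  rw [opp_apply, finsum_eq_sum_of_support_subset (s := hs.toFinset)]
  · rw [LinearMap.sum_apply]
    refine Finset.sum_eq_zero fun p hp => ?_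
    have hb := hB (Set.mem_image_of_mem _ (hs.mem_toFinset.1 hp))
    have : Y ((𝒱.L 1 ^ p.2) (𝒱.proj p.1 v)) (-n - p.2 - 2 + 2 * p.1) w = 0 :=
      hN p _ (by linarith)
    simp [oppTerm, this]
  · intro p hp
    rw [hs.coe_toFinset]
    by_contra hps
    exact hp (h n p hps)

end StronglyGradedVertexAlgebra

/-! ## Modules

`G` is an abelian group (the group `Ã`) with a subgroup `A`. -/

variable {G : Type*} [AddCommGroup G] {A : AddSubgroup G} {V : Type*} [AddCommGroup V] [Module ℂ V]

/-- The data underlying a strongly graded generalized module: a vector space, a vertex operator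
map, an action of `L(-1), L(0), L(1)` and a family of subspaces indexed by `G`.  The axioms are in
`IsGeneralizedModule`.  (The `ℂ`-grading is the one by generalized eigenspaces of `L(0)`.) -/
structure PreModule (𝒱 : StronglyGradedVertexAlgebra A V) where
  /-- the underlying vector space -/
  carrier : Type w
  [addCommGroup : AddCommGroup carrier]
  [module : Module ℂ carrier]
  /-- `Y v n = v_n` -/
  Y : V →ₗ[ℂ] ℤ → Module.End ℂ carrier
  /-- the action of `𝔰𝔩(2)` -/
  L : SignType → Module.End ℂ carrier
  /-- the homogeneous subspace `W^(β)` -/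
  gr : G → Submodule ℂ carrier

attribute [instance] PreModule.addCommGroup PreModule.module

namespace PreModule

variable {𝒱 : StronglyGradedVertexAlgebra A V}

/-- The weight space `W_[n]`: the generalized `n`-eigenspace of `L(0)`. -/
def wt (W : PreModule.{w} 𝒱) (n : ℂ) : Submodule ℂ W.carrier := (W.L 0).maxGenEigenspace n

/-- The modes `v^o_n` of the opposite vertex operator on `W`. -/
def Yo (W : PreModule.{w} 𝒱) : V →ₗ[ℂ] ℤ → Module.End ℂ W.carrier := 𝒱.opp W.Y

/-- `W` is a strongly graded generalized `V`-module.  When `V` is conformal the `𝔰𝔩(2)`-action is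
required to come from the conformal vector and the Virasoro relations are required.  (The ordinary
modules are the generalized modules on which `L(0)` is semisimple.) -/
structure IsGeneralizedModule (W : PreModule.{w} 𝒱) : Prop where
  lowerTruncated : LowerTruncated W.Y
  vacuum : VacuumAxiom 𝒱.vac W.Y
  jacobi : JacobiIdentity 𝒱.Y W.Y
  sl2 : Sl2Relations W.L
  sl2_bracket : Sl2Bracket 𝒱.L W.Y W.L
  derivative : DerivativeProperty 𝒱.L W.Y
  conformal : ∀ ω c, 𝒱.conf = some (ω, c) → VirasoroProperty ω c W.Y W.L
  weight_top : ⨆ n : ℂ, W.wt n = ⊤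
  gr_indep : iSupIndep W.gr
  gr_top : ⨆ β, W.gr β = ⊤
  gr_compatible : ∀ β, W.gr β = ⨆ n : ℂ, W.gr β ⊓ W.wt n
  gr_truncated : ∀ β (n : ℂ), ∃ K : ℤ, ∀ k : ℤ, k ≤ K → W.gr β ⊓ W.wt (n + k) = ⊥
  gr_finite : ∀ β (n : ℂ), FiniteDimensional ℂ ↥(W.gr β ⊓ W.wt n)
  Y_mem : ∀ (α : A) (β : G), ∀ v ∈ 𝒱.gr α, ∀ x ∈ W.gr β, ∀ n, W.Y v n x ∈ W.gr (α + β)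
  L_mem : ∀ j β, ∀ x ∈ W.gr β, W.L j x ∈ W.gr β

/-- A map of strongly graded generalized modules: it commutes with the vertex operators and with
`𝔰𝔩(2)` and preserves the `G`-grading. -/
@[ext]
structure Hom (W X : PreModule.{w} 𝒱) where
  /-- the underlying linear map -/
  toLinearMap : W.carrier →ₗ[ℂ] X.carrier
  map_Y : ∀ v n x, toLinearMap (W.Y v n x) = X.Y v n (toLinearMap x)
  map_L : ∀ j x, toLinearMap (W.L j x) = X.L j (toLinearMap x)
  map_gr : ∀ β, ∀ x ∈ W.gr β, toLinearMap x ∈ X.gr β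

/-- `W` and `X` are isomorphic: there are mutually inverse maps. -/
def Isomorphic (W X : PreModule.{w} 𝒱) : Prop :=
  ∃ (f : Hom W X) (g : Hom X W), (∀ x, g.toLinearMap (f.toLinearMap x) = x) ∧
    ∀ y, f.toLinearMap (g.toLinearMap y) = y

/-- The subspace `S` is stable under the vertex operators and under `𝔰𝔩(2)`. -/
def Stable (W : PreModule.{w} 𝒱) (S : Submodule ℂ W.carrier) : Prop :=
  (∀ v n, ∀ x ∈ S, W.Y v n x ∈ S) ∧ ∀ j, ∀ x ∈ S, W.L j x ∈ S

/-- A stable subspace `S`, with the restricted actions and `S^(β) = S ∩ W^(β)`. -/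
def sub (W : PreModule.{w} 𝒱) (S : Submodule ℂ W.carrier) (hS : W.Stable S) : PreModule.{w} 𝒱 where
  carrier := S
  Y :=
    { toFun := fun v n => (W.Y v n).restrict (hS.1 v n)
      map_add' := fun v v' => by
        funext n
        ext x
        simp
      map_smul' := fun c v => by
        funext n
        ext x
        simp }
  L j := (W.L j).restrict (hS.2 j)
  gr β := (W.gr β).comap S.subtype

theorem stable_range {W X : PreModule.{w} 𝒱} (f : Hom W X) :
    X.Stable (LinearMap.range f.toLinearMap) := by
  refine ⟨?_, ?_⟩
  · rintro v n _ ⟨x, rfl⟩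
    exact ⟨_, f.map_Y v n x⟩
  · rintro j _ ⟨x, rfl⟩
    exact ⟨_, f.map_L j x⟩

/-- The image of a map. -/
def image {W X : PreModule.{w} 𝒱} (f : Hom W X) : PreModule.{w} 𝒱 :=
  X.sub (LinearMap.range f.toLinearMap) (stable_range f)

/-- The direct sum of two modules. -/
def directSum (W X : PreModule.{w} 𝒱) : PreModule.{w} 𝒱 where
  carrier := W.carrier × X.carrier
  Y :=
    { toFun := fun v n => (W.Y v n).prodMap (X.Y v n)
      map_add' := fun v v' => by
        funext n
        ext x <;> simp
      map_smul' := fun c v => by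
        funext n
        ext x <;> simp }
  L j := (W.L j).prodMap (X.L j)
  gr β := (W.gr β).prod (X.gr β)

/-! ### The contragredient module -/

/-- The operator `T` is homogeneous: it maps `W_[k]^(β)` to `W_[k+s]^(β+α)`. -/
def Shifts (W : PreModule.{w} 𝒱) (α : G) (s : ℂ) : Submodule ℂ (Module.End ℂ W.carrier) where
  carrier := {T | ∀ β k, ∀ x ∈ W.gr β ⊓ W.wt k, T x ∈ W.gr (α + β) ⊓ W.wt (k + s)}
  add_mem' := fun hT hT' β k x hx => Submodule.add_mem _ (hT β k x hx) (hT' β k x hx)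
  zero_mem' := fun _ _ _ _ => Submodule.zero_mem _
  smul_mem' := fun c _ hT β k x hx => Submodule.smul_mem _ c (hT β k x hx)

theorem mem_wt_of_comm (W : PreModule.{w} 𝒱) {T : Module.End ℂ W.carrier} {s : ℂ}
    (hT : ⁅W.L 0, T⁆ = s • T) {k : ℂ} {x : W.carrier} (hx : x ∈ W.wt k) : T x ∈ W.wt (k + s) := by
  rw [wt, Module.End.mem_maxGenEigenspace] at hx ⊢
  obtain ⟨N, hN⟩ := hx
  have hc : (W.L 0 - (k + s) • (1 : Module.End ℂ W.carrier)) * T = T * (W.L 0 - k • 1) := by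
    rw [Ring.lie_def] at hT
    rw [sub_mul, mul_sub, sub_eq_iff_eq_add.1 hT, smul_mul_assoc, mul_smul_comm, one_mul, mul_one,
      add_smul]
    abel
  have hp : ∀ m : ℕ, (W.L 0 - (k + s) • (1 : Module.End ℂ W.carrier)) ^ m * T
      = T * (W.L 0 - k • 1) ^ m := by
    intro m
    induction m with
    | zero => simp
    | succ m ih => rw [pow_succ, mul_assoc, hc, ← mul_assoc, ih, mul_assoc, ← pow_succ]
  refine ⟨N, ?_⟩
  have := LinearMap.congr_fun (hp N) x
  rw [Module.End.mul_apply, Module.End.mul_apply, hN, map_zero] at this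
  exact this

theorem Y_shifts {W : PreModule.{w} 𝒱} (hW : W.IsGeneralizedModule) {α : A} {h : ℤ} {v : V}
    (hv : v ∈ 𝒱.gr α ⊓ 𝒱.wt h) (n : ℤ) : W.Y v n ∈ W.Shifts α (h - n - 1) := by
  intro β k x hx
  refine ⟨hW.Y_mem α β v hv.1 x hx.1 n, ?_⟩
  refine W.mem_wt_of_comm ?_ hx.2
  have h0 := hW.sl2_bracket 0 v n
  have hL : 𝒱.L 0 v = (h : ℂ) • v := Module.End.mem_eigenspace_iff.1 hv.2
  have hd := hW.derivative v (n + 1)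
  rw [h0]
  have e2 : (((0 : SignType) : ℤ) + 2).toNat = 2 := rfl
  rw [e2, Finset.sum_range_succ, Finset.sum_range_one]
  simp only [binom, Lop, SignType.coe_zero, zero_add, Nat.cast_zero, Nat.cast_one, zero_sub,
    sub_self, sign_zero, sub_zero, add_zero, add_sub_cancel_right, hL, map_smul]
  have e3 : SignType.sign (-1 : ℤ) = -1 := rfl
  rw [e3, hd]
  simp only [add_sub_cancel_right, Ring.choose_zero_right, Ring.choose_one_right, Int.cast_one,
    one_smul, Pi.smul_apply]
  push_cast
  rw [← add_smul]
  congr 1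
  ring

theorem Yo_shifts {W : PreModule.{w} 𝒱} (hW : W.IsGeneralizedModule) {α : A} {h : ℤ} {v : V}
    (hv : v ∈ 𝒱.gr α ⊓ 𝒱.wt h) (n : ℤ) : W.Yo v n ∈ W.Shifts α (n + 1 - h) := by
  rw [Yo, 𝒱.opp_apply]
  refine finsum_induction (· ∈ W.Shifts α (n + 1 - h)) (Submodule.zero_mem _)
    (fun _ _ => Submodule.add_mem _) fun p => ?_
  rw [StronglyGradedVertexAlgebra.oppTerm, LinearMap.smul_apply]
  refine Submodule.smul_mem _ _ ?_
  simp only [LinearMap.comp_apply, LinearMap.proj_apply, 𝒱.proj_of_mem hv.2]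
  split_ifs with hp
  · have h1 := Y_shifts hW (𝒱.L1_pow_mem hv p.2) (-n - p.2 - 2 + 2 * p.1)
    rw [hp] at h1 ⊢
    have e : (((h - (p.2 : ℤ) : ℤ) : ℂ) - ((-n - p.2 - 2 + 2 * h : ℤ) : ℂ) - 1) = n + 1 - h := by
      push_cast; ring
    rwa [e] at h1
  · simp

theorem L_shifts {W : PreModule.{w} 𝒱} (hW : W.IsGeneralizedModule) (j : SignType) :
    W.L j ∈ W.Shifts 0 (-((j : ℤ) : ℂ)) := by
  intro β k x hx
  refine ⟨by rw [zero_add]; exact hW.L_mem j β x hx.1, W.mem_wt_of_comm ?_ hx.2⟩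
  obtain ⟨h1, h2, _⟩ := hW.sl2
  cases j
  · change ⁅W.L 0, W.L 0⁆ = (-((0 : ℤ) : ℂ)) • W.L 0
    simp [Ring.lie_def]
  · change ⁅W.L 0, W.L (-1)⁆ = (-((-1 : ℤ) : ℂ)) • W.L (-1)
    simp [h1]
  · change ⁅W.L 0, W.L 1⁆ = (-((1 : ℤ) : ℂ)) • W.L 1
    simp [h2]

/-- The full dual space `W^*`, with `⟨Y'(v,x)f, x⟩ = ⟨f, Y^o(v,x)x⟩`, `⟨L'(j)f, x⟩ = ⟨f, L(-j)x⟩`, and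
the subspace of degree `β` consisting of the functionals vanishing on `W^(γ)` for `γ ≠ -β`. -/
def fullDual (W : PreModule.{w} 𝒱) : PreModule.{w} 𝒱 where
  carrier := Module.Dual ℂ W.carrier
  Y := LinearMap.pi fun n =>
    Module.Dual.transpose (R := ℂ) ∘ₗ LinearMap.proj n ∘ₗ W.Yo
  L j := Module.Dual.transpose (R := ℂ) (W.L (-j))
  gr β := ⨅ γ : {γ : G // γ ≠ -β}, (W.gr γ).dualAnnihilator

/-- `W' = ∐ (W_[n]^(β))^* ⊆ W^*`: the functionals that vanish on all but finitely many of the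
doubly homogeneous subspaces. -/
def gradedDual (W : PreModule.{w} 𝒱) : Submodule ℂ (Module.Dual ℂ W.carrier) where
  carrier := {f | {p : G × ℂ | ∃ x ∈ W.gr p.1 ⊓ W.wt p.2, f x ≠ 0}.Finite}
  add_mem' := by
    intro f g hf hg
    refine (Set.Finite.union hf hg).subset ?_
    rintro p ⟨x, hx, hne⟩
    by_cases h0 : f x = 0
    · right
      refine ⟨x, hx, fun h1 => hne ?_⟩
      rw [LinearMap.add_apply, h0, h1, add_zero]
    · exact Or.inl ⟨x, hx, h0⟩
  zero_mem' := by simp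
  smul_mem' := by
    intro c f hf
    refine Set.Finite.subset hf ?_
    rintro p ⟨x, hx, hne⟩
    refine ⟨x, hx, fun h0 => hne ?_⟩
    rw [LinearMap.smul_apply, h0, smul_zero]

theorem comp_mem_gradedDual {W : PreModule.{w} 𝒱} {α : G} {s : ℂ} {T : Module.End ℂ W.carrier}
    (hT : T ∈ W.Shifts α s) {f : Module.Dual ℂ W.carrier} (hf : f ∈ W.gradedDual) :
    f ∘ₗ T ∈ W.gradedDual := by
  have hinj : Function.Injective fun p : G × ℂ => ((α + p.1, p.2 + s) : G × ℂ) := by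
    rintro ⟨a, b⟩ ⟨c, d⟩ h
    simp only [Prod.mk.injEq, add_right_inj, add_left_inj] at h
    exact Prod.ext h.1 h.2
  refine (Set.Finite.preimage hinj.injOn hf).subset ?_
  rintro ⟨β, k⟩ ⟨x, hx, hne⟩
  exact ⟨T x, hT β k x hx, hne⟩

theorem gradedDual_stable {W : PreModule.{w} 𝒱} (hW : W.IsGeneralizedModule) :
    W.fullDual.Stable W.gradedDual := by
  refine ⟨fun v n (f : Module.Dual ℂ W.carrier) hf => ?_,
    fun j f hf => comp_mem_gradedDual (L_shifts hW (-j)) hf⟩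
  change f ∘ₗ W.Yo v n ∈ W.gradedDual
  refine 𝒱.homogeneous_induction (P := fun v => f ∘ₗ W.Yo v n ∈ W.gradedDual) (fun α h v hv => ?_)
    ?_ ?_ v
  · exact comp_mem_gradedDual (Yo_shifts hW hv n) hf
  · rw [map_zero, Pi.zero_apply, LinearMap.comp_zero]
    exact Submodule.zero_mem _
  · intro x y hx hy
    rw [map_add, Pi.add_apply, LinearMap.comp_add]
    exact Submodule.add_mem _ hx hy

/-- The contragredient `W'` of a strongly graded generalized module `W`. -/
def contragredient (W : PreModule.{w} 𝒱) (hW : W.IsGeneralizedModule) : PreModule.{w} 𝒱 :=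
  W.fullDual.sub W.gradedDual (gradedDual_stable hW)

/-! ### `Q(z)`-intertwining maps -/

/-- The formal completion `∏_{n ∈ ℂ} W_[n]`, as a space of functions `n ↦ f n ∈ W_[n]`. -/
def completion (W : PreModule.{w} 𝒱) : Submodule ℂ (ℂ → W.carrier) :=
  Submodule.pi Set.univ fun n => W.wt n

/-- The pairing `⟨w', f⟩` of `w' ∈ W'` with an element `f` of the completion of `W`; only finitely
many terms are nonzero if `f` lies in finitely many `G`-degrees. -/
def pairing (W : PreModule.{w} 𝒱) (w' : Module.Dual ℂ W.carrier) (f : W.completion) : ℂ :=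
  ∑ᶠ n : ℂ, w' (f.1 n)

/-- `I` is a `Q(z)`-intertwining map of type `(X; W₁ W₂)`.

`jacobi` is the identity
`z⁻¹ δ((x₁-x₀)/z) Y^o(v,x₀) I(w₁⊗w₂) = x₀⁻¹ δ((x₁-z)/x₀) I(Y₁^o(v,x₁)w₁⊗w₂)`
`  - x₀⁻¹ δ((z-x₁)/(-x₀)) I(w₁⊗Y₂(v,x₁)w₂)`
in the completion of `X`, for `v` of weight `h`: the weight `k` component of the coefficient of
`x₀^{-m-1} x₁^{-n-1}`.  Here `z⁻¹ δ((x₁-x₀)/z) = ∑_n (z+x₀)^n x₁^{-n-1}`, binomials are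
expanded in nonnegative powers of the second term, and `v^o_p`, being of weight `p+1-h`, acts on
the completion by `(v^o_p f)_k = v^o_p f_{k-(p+1-h)}`.

`sl2` is `L(-j) I(w₁⊗w₂) = ∑_i (j+1 choose i) (-z)^i I(L(i-j)w₁⊗w₂)`
`  - ∑_i (j+1 choose i) (-z)^i I(w₁⊗L(j-i)w₂)`, where `(L(-j)f)_k = L(-j) f_{k-j}`. -/
structure IsQIntertwining (z : ℂ) {W₁ W₂ X : PreModule.{w} 𝒱}
    (I : W₁.carrier ⊗[ℂ] W₂.carrier →ₗ[ℂ] X.completion) : Prop where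
  compatible : ∀ β γ, ∀ w₁ ∈ W₁.gr β, ∀ w₂ ∈ W₂.gr γ, ∀ n : ℂ, (I (w₁ ⊗ₜ w₂)).1 n ∈ X.gr (β + γ)
  lowerTruncated : ∀ w₁ w₂ (n : ℂ), ∃ M : ℕ, ∀ m : ℕ, M ≤ m → (I (w₁ ⊗ₜ w₂)).1 (n - m) = 0
  jacobi : ∀ (h : ℤ), ∀ v ∈ 𝒱.wt h, ∀ w₁ w₂ (m n : ℤ) (k : ℂ),
    (∑ᶠ i : ℕ, (binom n i * z ^ (n - i)) •
        X.Yo v (m + i) ((I (w₁ ⊗ₜ w₂)).1 (k - ((m : ℂ) + i + 1 - h))))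
      = (∑ᶠ i : ℕ, (binom m i * (-z) ^ i) • (I (W₁.Yo v (m + n - i) w₁ ⊗ₜ w₂)).1 k)
        - ∑ᶠ i : ℕ, (binom m i * (-z) ^ (m - i)) • (I (w₁ ⊗ₜ W₂.Y v (n + i) w₂)).1 k
  sl2 : ∀ (j : SignType) w₁ w₂ (k : ℂ),
    X.L (-j) ((I (w₁ ⊗ₜ w₂)).1 (k - ((j : ℤ) : ℂ)))
      = (∑ i ∈ Finset.range ((j : ℤ) + 2).toNat,
          (binom ((j : ℤ) + 1) i * (-z) ^ i) • (I (Lop W₁.L ((i : ℤ) - j) w₁ ⊗ₜ w₂)).1 k)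
        - ∑ i ∈ Finset.range ((j : ℤ) + 2).toNat,
          (binom ((j : ℤ) + 1) i * (-z) ^ i) • (I (w₁ ⊗ₜ Lop W₂.L ((j : ℤ) - i) w₂)).1 k

/-! ### The action of `V` and `𝔰𝔩(2)` on `(W₁ ⊗ W₂)^*` -/

/-- `∑_i (n choose i) (-z)^i v^o_{n-i}`, the action on `W₁` of `v ⊗ (t-z)^n` expanded in
nonnegative powers of `z` and then acted upon by the opposite-operator map. -/
def qLeft (z : ℂ) {W : PreModule.{w} 𝒱} (hW : W.IsGeneralizedModule) (n : ℤ) :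
    V →ₗ[ℂ] Module.End ℂ W.carrier :=
  have fin : ∀ v x, (Function.support fun i : ℕ =>
      (binom n i * (-z) ^ i) • W.Yo v (n - i) x).Finite := fun v x => by
    obtain ⟨N, hN⟩ := 𝒱.opp_truncated hW.lowerTruncated v x
    refine (Set.finite_Iio (n - N).toNat).subset fun i hi => ?_
    by_contra hni
    simp only [Set.mem_Iio, not_lt] at hni
    exact hi (by simp only [Yo]; rw [hN _ (by omega), smul_zero])
  LinearMap.mk₂ ℂ (fun v x => ∑ᶠ i : ℕ, (binom n i * (-z) ^ i) • W.Yo v (n - i) x)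
    (fun v v' x => by
      rw [← finsum_add_distrib (fin v x) (fin v' x)]
      simp)
    (fun c v x => by
      rw [smul_finsum' c (fin v x)]
      simp [smul_comm c])
    (fun v x x' => by
      rw [← finsum_add_distrib (fin v x) (fin v x')]
      simp)
    (fun c v x => by
      rw [smul_finsum' c (fin v x)]
      simp [smul_comm c])

/-- `∑_i (n choose i) (-z)^{n-i} v_i`, the action on `W₂` of `v ⊗ (-z+t)^n` expanded in
nonnegative powers of `t`. -/
def qRight (z : ℂ) {W : PreModule.{w} 𝒱} (hW : W.IsGeneralizedModule) (n : ℤ) :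
    V →ₗ[ℂ] Module.End ℂ W.carrier :=
  have fin : ∀ v x, (Function.support fun i : ℕ =>
      (binom n i * (-z) ^ (n - i)) • W.Y v i x).Finite := fun v x => by
    obtain ⟨N, hN⟩ := hW.lowerTruncated v x
    refine (Set.finite_Iio N.toNat).subset fun i hi => ?_
    by_contra hni
    simp only [Set.mem_Iio, not_lt] at hni
    exact hi (by simp only []; rw [hN _ (by omega), smul_zero])
  LinearMap.mk₂ ℂ (fun v x => ∑ᶠ i : ℕ, (binom n i * (-z) ^ (n - i)) • W.Y v i x)
    (fun v v' x => by
      rw [← finsum_add_distrib (fin v x) (fin v' x)]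
      simp)
    (fun c v x => by
      rw [smul_finsum' c (fin v x)]
      simp [smul_comm c])
    (fun v x x' => by
      rw [← finsum_add_distrib (fin v x) (fin v x')]
      simp)
    (fun c v x => by
      rw [smul_finsum' c (fin v x)]
      simp [smul_comm c])

/-- The homogeneous subspace `(W₁ ⊗ W₂)^(γ)`. -/
def tensorGr (W₁ W₂ : PreModule.{w} 𝒱) (γ : G) : Submodule ℂ (W₁.carrier ⊗[ℂ] W₂.carrier) :=
  Submodule.span ℂ {t | ∃ β δ, β + δ = γ ∧ ∃ w₁ ∈ W₁.gr β, ∃ w₂ ∈ W₂.gr δ, t = w₁ ⊗ₜ w₂}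

/-- `(W₁ ⊗ W₂)^*` with the action `Y'_{Q(z)}`,
`(Y'_{Q(z)}(v,x₀)λ)(w₁⊗w₂) = λ(Y₁^o(v,x₀+z)w₁⊗w₂)`
`  - Res_{x₁} x₀⁻¹ δ((z-x₁)/(-x₀)) λ(w₁⊗Y₂(v,x₁)w₂)`,
whose coefficient of `x₀^{-n-1}` is `λ(qLeft v w₁ ⊗ w₂) - λ(w₁ ⊗ qRight v w₂)`; the action
`(L'_{Q(z)}(j)λ)(w₁⊗w₂) = ∑_i (j+1 choose i) (-z)^i (λ(L(i-j)w₁⊗w₂) - λ(w₁⊗L(j-i)w₂))` of `𝔰𝔩(2)`;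
and the subspace of degree `β` of the functionals vanishing on `(W₁ ⊗ W₂)^(γ)` for `γ ≠ -β`. -/
def qDual (z : ℂ) {W₁ W₂ : PreModule.{w} 𝒱} (h₁ : W₁.IsGeneralizedModule)
    (h₂ : W₂.IsGeneralizedModule) : PreModule.{w} 𝒱 where
  carrier := Module.Dual ℂ (W₁.carrier ⊗[ℂ] W₂.carrier)
  Y := LinearMap.pi fun n =>
    Module.Dual.transpose (R := ℂ) ∘ₗ
      (LinearMap.rTensorHom W₂.carrier ∘ₗ qLeft z h₁ n -
        LinearMap.lTensorHom W₁.carrier ∘ₗ qRight z h₂ n)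
  L j := Module.Dual.transpose (R := ℂ)
    (∑ i ∈ Finset.range ((j : ℤ) + 2).toNat, (binom ((j : ℤ) + 1) i * (-z) ^ i) •
      ((Lop W₁.L ((i : ℤ) - j)).rTensor W₂.carrier - (Lop W₂.L ((j : ℤ) - i)).lTensor W₁.carrier))
  gr β := ⨅ γ : {γ : G // γ ≠ -β}, (tensorGr W₁ W₂ γ).dualAnnihilator

end PreModule

/-! ## The category, the `Q(z)`-tensor product and `W₁ ⊠-backslash_{Q(z)} W₂` -/

open PreModule

variable {𝒱 : StronglyGradedVertexAlgebra A V}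

/-- A full subcategory `𝒞` of the category of strongly graded generalized `V`-modules (given by
its class of objects, closed under isomorphism) that is closed under contragredients and under
finite direct sums.  Full subcategories of the category of ordinary modules are included. -/
structure ModuleCategory (𝒱 : StronglyGradedVertexAlgebra A V) where
  /-- the class of objects -/
  Obj : PreModule.{w} 𝒱 → Prop
  isModule : ∀ {W}, Obj W → W.IsGeneralizedModule
  iso : ∀ {W X}, Isomorphic W X → Obj W → Obj X
  contragredient : ∀ {W} (hW : Obj W), Obj (W.contragredient (isModule hW))
  directSum : ∀ {W X}, Obj W → Obj X → Obj (W.directSum X)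

/-- `𝒞` is closed under images: for an object `M` of `𝒞`, a generalized module `N` and a map
`M → N`, the image is an object of `𝒞`. -/
def ModuleCategory.ClosedUnderImages (𝒞 : ModuleCategory.{w} 𝒱) : Prop :=
  ∀ (M N : PreModule.{w} 𝒱), 𝒞.Obj M → N.IsGeneralizedModule → ∀ f : Hom M N, 𝒞.Obj (image f)

/-- `(W₀; I₀)` is a `Q(z)`-tensor product of `W₁` and `W₂` in `𝒞`: it is a `Q(z)`-product with
`W₀` in `𝒞`, and for any `Q(z)`-product `(W; I)` with `W` in `𝒞` there is a unique map
`η : W₀ → W` whose extension to completions carries `I₀` to `I`. -/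
def IsQTensorProduct (𝒞 : ModuleCategory.{w} 𝒱) (z : ℂ) {W₁ W₂ W₀ : PreModule.{w} 𝒱}
    (I₀ : W₁.carrier ⊗[ℂ] W₂.carrier →ₗ[ℂ] W₀.completion) : Prop :=
  𝒞.Obj W₀ ∧ IsQIntertwining z I₀ ∧
    ∀ (W : PreModule.{w} 𝒱), 𝒞.Obj W →
      ∀ I : W₁.carrier ⊗[ℂ] W₂.carrier →ₗ[ℂ] W.completion, IsQIntertwining z I →
        ∃! η : Hom W₀ W, ∀ t n, (I t).1 n = η.toLinearMap ((I₀ t).1 n)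

/-- The union of the images `I'(W') ⊆ (W₁ ⊗ W₂)^*`, `I'(w') = ⟨w', I(·)⟩`, over all `Q(z)`-products
`(W; I)` of `W₁` and `W₂` with `W` in `𝒞`. -/
def boxSet (𝒞 : ModuleCategory.{w} 𝒱) (z : ℂ) (W₁ W₂ : PreModule.{w} 𝒱) :
    Set (Module.Dual ℂ (W₁.carrier ⊗[ℂ] W₂.carrier)) :=
  {l | ∃ W : PreModule.{w} 𝒱, 𝒞.Obj W ∧
    ∃ I : W₁.carrier ⊗[ℂ] W₂.carrier →ₗ[ℂ] W.completion, IsQIntertwining z I ∧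
      ∃ w' ∈ W.gradedDual, ∀ t, l t = W.pairing w' (I t)}

/-- The linear subspace spanned by the union of the images `I'(W')`. -/
def box (𝒞 : ModuleCategory.{w} 𝒱) (z : ℂ) (W₁ W₂ : PreModule.{w} 𝒱) :
    Submodule ℂ (Module.Dual ℂ (W₁.carrier ⊗[ℂ] W₂.carrier)) :=
  Submodule.span ℂ (boxSet 𝒞 z W₁ W₂)

/-- The subspace `box` of `(W₁ ⊗ W₂)^*` with the restricted actions `Y'_{Q(z)}` and `L'_{Q(z)}`, when
it is stable under them. -/
def boxModule (𝒞 : ModuleCategory.{w} 𝒱) (z : ℂ) {W₁ W₂ : PreModule.{w} 𝒱} (h₁ : 𝒞.Obj W₁)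
    (h₂ : 𝒞.Obj W₂) (hS : (qDual z (𝒞.isModule h₁) (𝒞.isModule h₂)).Stable (box 𝒞 z W₁ W₂)) :
    PreModule.{w} 𝒱 :=
  (qDual z (𝒞.isModule h₁) (𝒞.isModule h₂)).sub (box 𝒞 z W₁ W₂) hS

/-- The pairing of `l ∈ W ≅ W''` with an element `f` of the completion of `W'`. -/
def bidualPairing {W : PreModule.{w} 𝒱} (hW : W.IsGeneralizedModule) (l : W.carrier)
    (f : (W.contragredient hW).completion) : ℂ :=
  (W.contragredient hW).pairing (Module.Dual.eval ℂ W.carrier l ∘ₗ W.gradedDual.subtype) f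

end VTC

end

/-! A `Q(z)`-product `(W; I)` is recorded by its dual `I' : W' → (W₁ ⊗ W₂)^*`. Pairing the Jacobi
identity with `w'` and keeping the coefficient of `x₁⁻¹` leaves exactly the definition of
`Y'_{Q(z)}`, so `I'` is a map of modules (`dualHom`). The remaining coefficients say that every
functional `I'(w')` satisfies the compatibility condition `Compatible`.

The union of the images is a subspace because `I'(f) + J'(g) = (I, J)'(f, g)`, where `(I, J)` is a
product with values in the direct sum (`isQIntertwining_prod`).

Suppose that the box, `B`, is an object. Set `⟨l, I₀(t)_n⟩ = (π_n l)(t)`, with `π_n` the projection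
of `B` onto weight `n`. The Jacobi identity for `I₀` is then the compatibility condition on elements
of `B`, which holds since each of them is some `I'(w')` (`isQIntertwining_eval`). Given `(W; I)`,
the map `I'` lands in `B`, and its transpose `B' → W'' = W` is the required map (`lift_eval`). A map
`B' → W` is determined by its transpose `W' → B'' = B`, and an element of `B` is determined by its
values on tensors, whence uniqueness (`hom_ext_of_eval`). Finite dimension of the doubly homogeneous
subspaces gives `W'' = W` (`exists_eval`).

Conversely, if `(W₀; I₀)` is a tensor product, then `I = η̄ ∘ I₀` gives `I' = I₀' ∘ η'`. Hence `B`
is the image of `W₀'` alone. As a quotient of a generalized module with independent grading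
subspaces it is a generalized module (`isGeneralizedModule_of_surjective`), and closure under images
applies. -/

noncomputable section

namespace VTC

universe w

/-! ## Projections of an internal direct sum -/

section Decomposition

variable {ι M : Type*} [AddCommGroup M] [Module ℂ M] {D : ι → Submodule ℂ M}

open Classical in
/-- The projection onto the summand `D i` of an internal direct sum. -/
def decompProj (hi : iSupIndep D) (ht : ⨆ i, D i = ⊤) (i : ι) : M →ₗ[ℂ] M :=
  (D i).subtype ∘ₗ DirectSum.component ℂ ι (fun i => D i) i ∘ₗ
    (LinearEquiv.ofBijective (DirectSum.coeLinearMap D)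
      (DirectSum.isInternal_submodule_of_iSupIndep_of_iSup_eq_top hi ht)).symm.toLinearMap

variable (hi : iSupIndep D) (ht : ⨆ i, D i = ⊤)

theorem decompProj_mem (i : ι) (x : M) : decompProj hi ht i x ∈ D i := by
  simp only [decompProj, LinearMap.comp_apply, Submodule.subtype_apply]
  exact Submodule.coe_mem _

open Classical in
theorem decompProj_of_mem {i : ι} {x : M} (hx : x ∈ D i) (j : ι) :
    decompProj hi ht j x = if j = i then x else 0 := by
  have : (LinearEquiv.ofBijective (DirectSum.coeLinearMap D)
      (DirectSum.isInternal_submodule_of_iSupIndep_of_iSup_eq_top hi ht)).symm x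
      = DirectSum.lof ℂ ι (fun i => D i) i ⟨x, hx⟩ := by
    rw [LinearEquiv.symm_apply_eq]
    exact (DirectSum.coeLinearMap_lof D i ⟨x, hx⟩).symm
  simp only [decompProj, LinearMap.comp_apply, LinearEquiv.coe_coe, this]
  split_ifs with h
  · subst h
    simp [DirectSum.component.lof_self]
  · rw [DirectSum.component.of, dif_neg (Ne.symm h)]
    simp

theorem decompProj_same {i : ι} {x : M} (hx : x ∈ D i) : decompProj hi ht i x = x := by
  rw [decompProj_of_mem hi ht hx, if_pos rfl]

theorem decompProj_ne {i j : ι} {x : M} (hx : x ∈ D i) (h : j ≠ i) : decompProj hi ht j x = 0 := by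
  rw [decompProj_of_mem hi ht hx, if_neg h]

theorem decompProj_finite (x : M) : (Function.support fun i => decompProj hi ht i x).Finite := by
  have hx : x ∈ ⨆ i, D i := by rw [ht]; trivial
  refine Submodule.iSup_induction D
    (motive := fun x => (Function.support fun i => decompProj hi ht i x).Finite) hx
    (fun i y hy => ?_) (by simp) fun y y' h h' => ?_
  · refine (Set.finite_singleton i).subset fun j hj => ?_
    by_contra hne
    exact hj (decompProj_ne hi ht hy hne)
  · refine (h.union h').subset ?_
    simp only [map_add]
    exact Function.support_add _ _

theorem finsum_decompProj (x : M) : ∑ᶠ i, decompProj hi ht i x = x := by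
  have hx : x ∈ ⨆ i, D i := by rw [ht]; trivial
  refine Submodule.iSup_induction D
    (motive := fun x => ∑ᶠ i, decompProj hi ht i x = x) hx
    (fun i y hy => ?_) (by simp) fun y y' h h' => ?_
  · rw [finsum_eq_single _ i fun j hj => decompProj_ne hi ht hy hj, decompProj_same hi ht hy]
  · simp only [map_add]
    rw [finsum_add_distrib (decompProj_finite hi ht y) (decompProj_finite hi ht y'), h, h']

end Decomposition

/-! ## The opposite vertex operator -/

namespace StronglyGradedVertexAlgebra

variable {A : Type*} [AddCommGroup A] {V : Type*} [AddCommGroup V] [Module ℂ V]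
  (𝒱 : StronglyGradedVertexAlgebra A V)
  {W : Type*} [AddCommGroup W] [Module ℂ W]

/-- The cutoff `M` is free, so that iterated sums can later be given a common triangular range. -/
theorem opp_of_mem {h : ℤ} {v : V} (hv : v ∈ 𝒱.wt h) (Y : V →ₗ[ℂ] ℤ → Module.End ℂ W) (n : ℤ)
    {M : ℕ} (hM : ∀ m, M ≤ m → (𝒱.L 1 ^ m) v = 0) :
    𝒱.opp Y v n = ∑ m ∈ Finset.range M,
      ((-1 : ℂ) ^ h * ((m.factorial : ℂ))⁻¹) • Y ((𝒱.L 1 ^ m) v) (-n - m - 2 + 2 * h) := by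
  have hinj : Function.Injective fun m : ℕ => ((h, m) : ℤ × ℕ) := fun a b hab => by simpa using hab
  rw [opp_apply, finsum_eq_sum_of_support_subset (s := (Finset.range M).map ⟨_, hinj⟩),
    Finset.sum_map]
  · refine Finset.sum_congr rfl fun m _ => ?_
    simp [oppTerm, 𝒱.proj_of_mem hv]
  · rintro ⟨k, m⟩ hp
    have hk : k = h := by
      by_contra hk
      exact hp (by simp [oppTerm, 𝒱.proj_of_mem hv, hk])
    subst hk
    have hm : m < M := by
      by_contra hm
      exact hp (by simp [oppTerm, 𝒱.proj_of_mem hv, hM m (not_lt.1 hm)])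
    simpa using hm

/-- These are the coefficients of `e^{-x} e^x = 1`; multiplied by `s!` they become alternating sums
of binomial coefficients. -/
theorem alternating_sum_inv_factorial (s : ℕ) :
    ∑ m ∈ Finset.range (s + 1), ((-1 : ℂ) ^ m * ((m.factorial : ℂ))⁻¹ * (((s - m).factorial : ℂ))⁻¹)
      = if s = 0 then 1 else 0 := by
  have h := congrArg (fun k : ℤ => (k : ℂ)) (Int.alternating_sum_range_choose (n := s))
  have e : ∑ m ∈ Finset.range (s + 1),
      ((-1 : ℂ) ^ m * ((m.factorial : ℂ))⁻¹ * (((s - m).factorial : ℂ))⁻¹)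
      = ((s.factorial : ℂ))⁻¹ *
        ((∑ m ∈ Finset.range (s + 1), ((-1) ^ m * (s.choose m : ℤ)) : ℤ) : ℂ) := by
    push_cast
    rw [Finset.mul_sum]
    refine Finset.sum_congr rfl fun m hm => ?_
    have hms : m ≤ s := Nat.lt_succ_iff.1 (Finset.mem_range.1 hm)
    rw [Nat.cast_choose ℂ hms]
    have := Nat.cast_ne_zero (R := ℂ).2 s.factorial_ne_zero
    field_simp
  rw [e]
  rw [h]
  split_ifs with hs
  · subst hs; simp
  · simp

/-- `Y^{oo} = Y`. -/
theorem opp_opp (Y : V →ₗ[ℂ] ℤ → Module.End ℂ W) (v : V) (n : ℤ) :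
    𝒱.opp (𝒱.opp Y) v n = Y v n := by
  refine 𝒱.homogeneous_induction (P := fun v => 𝒱.opp (𝒱.opp Y) v n = Y v n)
    (fun α h v hv => ?_) (by simp) (fun x y hx hy => by simp [hx, hy]) v
  obtain ⟨M, hM⟩ := 𝒱.L1_nilpotent v
  rw [𝒱.opp_of_mem hv.2 _ n (M := M + 1) fun m hm => hM m (by omega)]
  -- `L(1)^m v` has weight `h - m`, so the two signs combine to `(-1)^m` and the two index
  -- reflections to `n - (m + q)`.
  have inner : ∀ m ∈ Finset.range (M + 1),
      ((-1 : ℂ) ^ h * ((m.factorial : ℂ))⁻¹) • 𝒱.opp Y ((𝒱.L 1 ^ m) v) (-n - m - 2 + 2 * h)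
      = ∑ q ∈ Finset.range (M + 1 - m), ((-1 : ℂ) ^ m * ((m.factorial : ℂ))⁻¹ *
          ((q.factorial : ℂ))⁻¹) • Y ((𝒱.L 1 ^ (m + q)) v) (n - (m + q : ℕ)) := by
    intro m _
    rw [𝒱.opp_of_mem (𝒱.L1_pow_mem hv m).2 Y _ (M := M + 1 - m) fun q hq => by
      rw [← Module.End.mul_apply, ← pow_add]; exact hM _ (by omega), Finset.smul_sum]
    refine Finset.sum_congr rfl fun q _ => ?_
    rw [smul_smul, ← Module.End.mul_apply, ← pow_add, add_comm q m]
    congr 1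
    · have h1 : (-1 : ℂ) ^ h * (-1 : ℂ) ^ (h - m : ℤ) = (-1 : ℂ) ^ m := by
        rw [← zpow_add₀ (by norm_num), show h + (h - m) = 2 * (h - m) + (m : ℤ) by ring,
          zpow_add₀ (by norm_num), zpow_mul]
        simp
      rw [← h1]
      ring
    · refine congrArg (Y _) ?_
      push_cast
      ring
  -- Regrouped along `s = m + q`, the coefficient of `L(1)^s v` is that of `e^{-x} e^x`, so only `s
  -- = 0` survives.
  rw [Finset.sum_congr rfl inner, ← Finset.sum_range_diag_flip (M + 1) fun m q =>
    ((-1 : ℂ) ^ m * ((m.factorial : ℂ))⁻¹ * ((q.factorial : ℂ))⁻¹) •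
      Y ((𝒱.L 1 ^ (m + q)) v) (n - (m + q : ℕ))]
  have outer : ∀ s ∈ Finset.range (M + 1), ∑ m ∈ Finset.range (s + 1),
      ((-1 : ℂ) ^ m * ((m.factorial : ℂ))⁻¹ * (((s - m).factorial : ℂ))⁻¹) •
        Y ((𝒱.L 1 ^ (m + (s - m))) v) (n - (m + (s - m) : ℕ))
      = (if s = 0 then (1 : ℂ) else 0) • Y ((𝒱.L 1 ^ s) v) (n - s) := by
    intro s _
    rw [← alternating_sum_inv_factorial, Finset.sum_smul]
    refine Finset.sum_congr rfl fun m hm => ?_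
    rw [Nat.add_sub_cancel' (Nat.lt_succ_iff.1 (Finset.mem_range.1 hm))]
  rw [Finset.sum_congr rfl outer, Finset.sum_eq_single 0]
  · simp
  · intro s _ hs
    rw [if_neg hs, zero_smul]
  · simp

/-- A linear relation between two vertex operators passes to their opposites. -/
theorem opp_congr {W' X : Type*} [AddCommGroup W'] [Module ℂ W'] [AddCommGroup X] [Module ℂ X]
    {Y : V →ₗ[ℂ] ℤ → Module.End ℂ W} {Y' : V →ₗ[ℂ] ℤ → Module.End ℂ W'}
    (φ : Module.End ℂ W →ₗ[ℂ] X) (ψ : Module.End ℂ W' →ₗ[ℂ] X)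
    (hφ : ∀ v n, φ (Y v n) = ψ (Y' v n)) (v : V) (n : ℤ) :
    φ (𝒱.opp Y v n) = ψ (𝒱.opp Y' v n) := by
  refine 𝒱.homogeneous_induction (P := fun v => φ (𝒱.opp Y v n) = ψ (𝒱.opp Y' v n))
    (fun α h v hv => ?_) (by simp) (fun x y hx hy => by simp [hx, hy]) v
  obtain ⟨M, hM⟩ := 𝒱.L1_nilpotent v
  rw [𝒱.opp_of_mem hv.2 Y n hM, 𝒱.opp_of_mem hv.2 Y' n hM]
  simp only [map_sum, map_smul, hφ]

end StronglyGradedVertexAlgebra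

variable {G : Type*} [AddCommGroup G] {A : AddSubgroup G} {V : Type*} [AddCommGroup V] [Module ℂ V]
  {𝒱 : StronglyGradedVertexAlgebra A V}

namespace PreModule

/-! ## Doubly homogeneous subspaces -/

theorem wt_indep (W : PreModule.{w} 𝒱) : iSupIndep W.wt :=
  Module.End.independent_maxGenEigenspace (W.L 0)

theorem dh_induction {W : PreModule.{w} 𝒱} (hW : W.IsGeneralizedModule) {P : W.carrier → Prop}
    (hom : ∀ β n, ∀ x ∈ W.gr β ⊓ W.wt n, P x) (zero : P 0)
    (add : ∀ x y, P x → P y → P (x + y)) (x : W.carrier) : P x := by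
  have hx : x ∈ ⨆ β, W.gr β := by rw [hW.gr_top]; trivial
  refine Submodule.iSup_induction _ (motive := P) hx (fun β x hx => ?_) zero add
  rw [hW.gr_compatible β] at hx
  exact Submodule.iSup_induction _ (motive := P) hx (fun n y hy => hom β n y hy) zero add

/-- The projection of `W` onto `W_[n]`. -/
def wtProj {W : PreModule.{w} 𝒱} (hW : W.IsGeneralizedModule) (n : ℂ) : Module.End ℂ W.carrier :=
  decompProj W.wt_indep hW.weight_top n

/-- The projection of `W` onto `W^(β)`. -/
def grProj {W : PreModule.{w} 𝒱} (hW : W.IsGeneralizedModule) (β : G) : Module.End ℂ W.carrier :=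
  decompProj hW.gr_indep hW.gr_top β

/-- The projection of `W` onto `W_[n]^(β)`. -/
def dhProj {W : PreModule.{w} 𝒱} (hW : W.IsGeneralizedModule) (p : G × ℂ) :
    Module.End ℂ W.carrier :=
  wtProj hW p.2 ∘ₗ grProj hW p.1

section

variable {W : PreModule.{w} 𝒱} (hW : W.IsGeneralizedModule)

theorem wtProj_mem (n : ℂ) (x : W.carrier) : wtProj hW n x ∈ W.wt n := decompProj_mem _ _ _ _

theorem wtProj_same {n : ℂ} {x : W.carrier} (hx : x ∈ W.wt n) : wtProj hW n x = x :=
  decompProj_same _ _ hx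

theorem wtProj_ne {n m : ℂ} {x : W.carrier} (hx : x ∈ W.wt n) (h : m ≠ n) : wtProj hW m x = 0 :=
  decompProj_ne _ _ hx h

theorem wtProj_mem_gr (n : ℂ) {β : G} {x : W.carrier} (hx : x ∈ W.gr β) :
    wtProj hW n x ∈ W.gr β := by
  rw [hW.gr_compatible β] at hx
  refine Submodule.iSup_induction _ (motive := fun x => wtProj hW n x ∈ W.gr β) hx
    (fun m y hy => ?_) (by simp) fun x y h h' => by rw [map_add]; exact add_mem h h'
  by_cases hn : n = m
  · subst hn; rw [wtProj_same hW hy.2]; exact hy.1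
  · rw [wtProj_ne hW hy.2 hn]; exact zero_mem _

theorem wtProj_shift {T : Module.End ℂ W.carrier} {s : ℂ}
    (hT : ∀ k, ∀ x ∈ W.wt k, T x ∈ W.wt (k + s)) (k : ℂ) (x : W.carrier) :
    wtProj hW (k + s) (T x) = T (wtProj hW k x) := by
  have hx : x ∈ ⨆ n, W.wt n := by rw [hW.weight_top]; trivial
  refine Submodule.iSup_induction _
    (motive := fun x => wtProj hW (k + s) (T x) = T (wtProj hW k x)) hx
    (fun m y hy => ?_) (by simp) fun x y h h' => by simp only [map_add, h, h']
  by_cases hn : k = m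
  · subst hn; rw [wtProj_same hW hy, wtProj_same hW (hT _ _ hy)]
  · rw [wtProj_ne hW hy hn, wtProj_ne hW (hT _ _ hy) fun h => hn (add_right_cancel h), map_zero]

theorem wtProj_grProj (n : ℂ) (β : G) (x : W.carrier) :
    wtProj hW n (grProj hW β x) = grProj hW β (wtProj hW n x) := by
  refine dh_induction hW (P := fun x => wtProj hW n (grProj hW β x) = grProj hW β (wtProj hW n x))
    (fun γ m x hx => ?_) (by simp) (fun x y h h' => by simp only [map_add, h, h']) x
  have h := wtProj_mem_gr hW n hx.1
  by_cases hβ : β = γ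
  · subst hβ
    rw [grProj, decompProj_same _ _ hx.1, decompProj_same _ _ h]
  · rw [grProj, decompProj_ne _ _ hx.1 hβ, decompProj_ne _ _ h hβ, map_zero]

theorem dhProj_mem (p : G × ℂ) (x : W.carrier) : dhProj hW p x ∈ W.gr p.1 ⊓ W.wt p.2 :=
  ⟨wtProj_mem_gr hW _ (decompProj_mem _ _ _ _), wtProj_mem hW _ _⟩

theorem dhProj_same {p : G × ℂ} {x : W.carrier} (hx : x ∈ W.gr p.1 ⊓ W.wt p.2) :
    dhProj hW p x = x := by
  rw [dhProj, LinearMap.comp_apply, grProj, decompProj_same _ _ hx.1, wtProj_same hW hx.2]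

theorem dhProj_ne {p q : G × ℂ} {x : W.carrier} (hx : x ∈ W.gr p.1 ⊓ W.wt p.2) (h : q ≠ p) :
    dhProj hW q x = 0 := by
  rw [dhProj, LinearMap.comp_apply, grProj]
  by_cases h1 : q.1 = p.1
  · rw [h1, decompProj_same _ _ hx.1, wtProj_ne hW hx.2 fun h2 => h (Prod.ext h1 h2)]
  · rw [decompProj_ne _ _ hx.1 h1, map_zero]

theorem dhProj_finite (x : W.carrier) : (Function.support fun p => dhProj hW p x).Finite := by
  refine dh_induction hW (P := fun x => (Function.support fun p => dhProj hW p x).Finite)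
    (fun β n y hy => ?_) (by simp) (fun y y' h h' => ?_) x
  · refine (Set.finite_singleton (β, n)).subset fun q hq => ?_
    by_contra hne
    exact hq (dhProj_ne hW (p := (β, n)) hy hne)
  · refine (h.union h').subset ?_
    simp only [map_add]
    exact Function.support_add _ _

theorem finsum_dhProj (x : W.carrier) : ∑ᶠ p, dhProj hW p x = x := by
  refine dh_induction hW (P := fun x => ∑ᶠ p, dhProj hW p x = x)
    (fun β n y hy => ?_) (by simp) (fun y y' h h' => ?_) x
  · rw [finsum_eq_single _ (β, n) fun q hq => dhProj_ne hW (p := (β, n)) hy hq,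
      dhProj_same hW (p := (β, n)) hy]
  · simp only [map_add]
    rw [finsum_add_distrib (dhProj_finite hW y) (dhProj_finite hW y'), h, h']

theorem eq_zero_of_dhProj {x : W.carrier} (h : ∀ p, dhProj hW p x = 0) : x = 0 := by
  rw [← finsum_dhProj hW x]
  simp [h]

/-- `L(0) - k` is nilpotent on `W_[k]^(β)`. -/
theorem exists_pow_eq_zero {W : PreModule.{w} 𝒱} (hW : W.IsGeneralizedModule) (β : G) (k : ℂ) :
    ∃ N : ℕ, ∀ M, N ≤ M → ∀ x ∈ W.gr β ⊓ W.wt k, ((W.L 0 - k • 1) ^ M) x = 0 := by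
  have := hW.gr_finite β k
  -- Finite dimension makes the exponent uniform: take the largest one needed on a finite spanning
  -- set.
  obtain ⟨s, hs⟩ := Module.Finite.iff_fg.1 this
  have hsw : ∀ x ∈ s, ∃ N : ℕ, ((W.L 0 - k • 1) ^ N) x = 0 := fun x hx => by
    have : x ∈ W.gr β ⊓ W.wt k := hs ▸ Submodule.subset_span hx
    exact Module.End.mem_maxGenEigenspace _ _ _ |>.1 this.2
  choose! N hN using hsw
  refine ⟨s.sup N, fun M hM => ?_⟩
  change W.gr β ⊓ W.wt k ≤ LinearMap.ker ((W.L 0 - k • 1) ^ M)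
  rw [← hs, Submodule.span_le]
  intro x hx
  have h1 : N x ≤ M := (Finset.le_sup hx).trans hM
  change ((W.L 0 - k • 1) ^ M) x = 0
  rw [← Nat.sub_add_cancel h1, pow_add, Module.End.mul_apply, hN x hx, map_zero]

/-- A vector of `W ^ (β)` whose weight lies sufficiently far down vanishes. -/
theorem wtProj_truncated (β : G) (n : ℂ) :
    ∃ M : ℕ, ∀ m : ℕ, M ≤ m → ∀ x ∈ W.gr β, wtProj hW (n - m) x = 0 := by
  obtain ⟨K, hK⟩ := hW.gr_truncated β n
  refine ⟨(-K).toNat, fun m hm x hx => ?_⟩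
  have h := hK (-(m : ℤ)) (by omega)
  have hm : wtProj hW (n - m) x ∈ W.gr β ⊓ W.wt (n + ((-(m : ℤ) : ℤ) : ℂ)) := by
    refine ⟨wtProj_mem_gr hW _ hx, ?_⟩
    have e : n + ((-(m : ℤ) : ℤ) : ℂ) = n - m := by push_cast; ring
    rw [e]
    exact wtProj_mem hW _ _
  rw [h] at hm
  exact (Submodule.mem_bot ℂ).1 hm

/-! ## The contragredient -/

/-- An element of the contragredient, as a functional. -/
def contraVal : (W.contragredient hW).carrier →ₗ[ℂ] Module.Dual ℂ W.carrier :=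
  W.gradedDual.subtype

theorem contraVal_injective : Function.Injective (contraVal hW) :=
  W.gradedDual.subtype_injective

theorem contraVal_mem (f : (W.contragredient hW).carrier) : contraVal hW f ∈ W.gradedDual :=
  Subtype.property (p := fun f => f ∈ W.gradedDual) f

/-- An element of the contragredient. -/
def contraMk (f : Module.Dual ℂ W.carrier) (hf : f ∈ W.gradedDual) :
    (W.contragredient hW).carrier := (⟨f, hf⟩ : W.gradedDual)

@[simp] theorem contraVal_mk (f : Module.Dual ℂ W.carrier) (hf : f ∈ W.gradedDual) :
    contraVal hW (contraMk hW f hf) = f := rfl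

theorem contra_L_apply (j : SignType) (f : (W.contragredient hW).carrier) (x : W.carrier) :
    contraVal hW ((W.contragredient hW).L j f) x = contraVal hW f (W.L (-j) x) := rfl

theorem contra_Y_apply (v : V) (n : ℤ) (f : (W.contragredient hW).carrier) (x : W.carrier) :
    contraVal hW ((W.contragredient hW).Y v n f) x = contraVal hW f (W.Yo v n x) := rfl

/-- The vertex operator of `W'` is the transpose of `Y^o`, so its opposite is the transpose of
`Y^{oo} = Y`. -/
theorem contra_Yo_apply (v : V) (n : ℤ) (f : (W.contragredient hW).carrier) (x : W.carrier) :
    contraVal hW ((W.contragredient hW).Yo v n f) x = contraVal hW f (W.Y v n x) := by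
  have h := 𝒱.opp_congr (Y := (W.contragredient hW).Y) (Y' := W.Yo)
    (LinearMap.applyₗ x ∘ₗ contraVal hW ∘ₗ LinearMap.applyₗ f)
    (contraVal hW f ∘ₗ LinearMap.applyₗ x) (fun v n => contra_Y_apply hW v n f x) v n
  have e : 𝒱.opp W.Yo v n = W.Y v n := 𝒱.opp_opp W.Y v n
  rw [e] at h
  exact h

theorem mem_contra_gr {β : G} {f : (W.contragredient hW).carrier} :
    f ∈ (W.contragredient hW).gr β ↔ ∀ γ, γ ≠ -β → ∀ x ∈ W.gr γ, contraVal hW f x = 0 := by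
  change contraVal hW f ∈ (⨅ γ : {γ : G // γ ≠ -β}, (W.gr γ).dualAnnihilator) ↔ _
  simp only [Submodule.mem_iInf, Submodule.mem_dualAnnihilator, Subtype.forall]

theorem contra_pow_apply (k : ℂ) (N : ℕ) (f : (W.contragredient hW).carrier) (x : W.carrier) :
    contraVal hW ((((W.contragredient hW).L 0 - k • 1) ^ N) f) x
      = contraVal hW f (((W.L 0 - k • 1) ^ N) x) := by
  induction N generalizing f with
  | zero => simp
  | succ N ih =>
    rw [pow_succ, Module.End.mul_apply, ih, pow_succ', Module.End.mul_apply]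
    simp only [LinearMap.sub_apply, map_sub, contra_L_apply, neg_zero, LinearMap.smul_apply,
      Module.End.one_apply, map_smul]

/-- The functional `f` is nonzero on only finitely many doubly homogeneous subspaces, and on each
one of weight `k` some power of `L(0) - k` vanishes. The largest of these exponents serves for `f`.
-/
theorem mem_contra_wt {k : ℂ} {f : (W.contragredient hW).carrier}
    (h : ∀ n, n ≠ k → ∀ x ∈ W.wt n, contraVal hW f x = 0) : f ∈ (W.contragredient hW).wt k := by
  choose N hN using fun β => exists_pow_eq_zero hW β k
  have hfin : {p : G × ℂ | ∃ x ∈ W.gr p.1 ⊓ W.wt p.2, contraVal hW f x ≠ 0}.Finite :=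
    contraVal_mem hW f
  rw [wt, Module.End.mem_maxGenEigenspace]
  refine ⟨hfin.toFinset.sup fun p => N p.1, contraVal_injective hW ?_⟩
  ext x
  rw [contra_pow_apply, map_zero, LinearMap.zero_apply]
  refine dh_induction hW (P := fun x => contraVal hW f
    (((W.L 0 - k • 1) ^ hfin.toFinset.sup fun p => N p.1) x) = 0) (fun β n x hx => ?_)
    (by simp) (fun x y h h' => by rw [map_add, map_add, h, h', add_zero]) x
  have hmem : ∀ M : ℕ, ((W.L 0 - k • 1) ^ M) x ∈ W.gr β ⊓ W.wt n := by
    intro M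
    induction M with
    | zero => simpa using hx
    | succ M ih =>
      rw [pow_succ', Module.End.mul_apply]
      have h0 := L_shifts hW 0 β n _ ih
      rw [zero_add, SignType.coe_zero, Int.cast_zero, neg_zero, add_zero] at h0
      simp only [LinearMap.sub_apply, LinearMap.smul_apply, Module.End.one_apply]
      exact sub_mem h0 (Submodule.smul_mem _ _ ih)
  by_cases hn : n = k
  · subst hn
    by_cases hS : (β, n) ∈ hfin.toFinset
    · rw [hN β _ (Finset.le_sup (f := fun p : G × ℂ => N p.1) hS) x hx, map_zero]
    -- Outside the finite support of `f` the exponent is irrelevant: powers of `L(0) - k` stay in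
    -- the same homogeneous subspace, where `f` vanishes.
    · by_contra hne
      exact hS (hfin.mem_toFinset.2 ⟨_, hmem _, hne⟩)
  · exact h n hn _ (hmem _).2

/-- A functional on `W`, restricted to `W_[n]^(β)` and extended by zero. -/
def homDual (p : G × ℂ) (g : Module.Dual ℂ W.carrier) : (W.contragredient hW).carrier :=
  contraMk hW (g ∘ₗ dhProj hW p) <| (Set.finite_singleton p).subset <| by
    rintro q ⟨x, hx, hne⟩
    by_contra h
    exact hne (by rw [LinearMap.comp_apply, dhProj_ne hW hx (Ne.symm h), map_zero])

theorem homDual_apply (p : G × ℂ) (g : Module.Dual ℂ W.carrier) (x : W.carrier) :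
    contraVal hW (homDual hW p g) x = g (dhProj hW p x) := rfl

theorem homDual_mem_gr (p : G × ℂ) (g : Module.Dual ℂ W.carrier) :
    homDual hW p g ∈ (W.contragredient hW).gr (-p.1) := by
  rw [mem_contra_gr]
  intro γ hγ x hx
  rw [neg_neg] at hγ
  rw [homDual_apply, dhProj, LinearMap.comp_apply, grProj, decompProj_ne _ _ hx hγ.symm, map_zero,
    map_zero]

theorem homDual_apply_of_ne {p : G × ℂ} {n : ℂ} (hn : n ≠ p.2) (g : Module.Dual ℂ W.carrier)
    {x : W.carrier} (hx : x ∈ W.wt n) : contraVal hW (homDual hW p g) x = 0 := by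
  have : dhProj hW p x = 0 := by
    rw [dhProj, LinearMap.comp_apply, wtProj_grProj, wtProj_ne hW hx hn.symm, map_zero]
  rw [homDual_apply, this, map_zero]

theorem homDual_mem_wt (p : G × ℂ) (g : Module.Dual ℂ W.carrier) :
    homDual hW p g ∈ (W.contragredient hW).wt p.2 :=
  mem_contra_wt hW fun _ hn _ hx => homDual_apply_of_ne hW hn g hx

/-- The homogeneous functionals separate the points of `W`. -/
theorem eq_of_homDual {x y : W.carrier}
    (h : ∀ p g, contraVal hW (homDual hW p g) x = contraVal hW (homDual hW p g) y) : x = y := by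
  rw [← sub_eq_zero]
  refine eq_zero_of_dhProj hW fun p => ?_
  rw [← Module.forall_dual_apply_eq_zero_iff ℂ]
  intro g
  rw [map_sub, map_sub, sub_eq_zero]
  exact h p g

/-- Finiteness is the membership of `f` in the graded dual; evaluated at `x`, the sum is `f` applied
to the decomposition of `x`. -/
theorem finsum_homDual (f : (W.contragredient hW).carrier) :
    (Function.support fun p => homDual hW p (contraVal hW f)).Finite ∧
      ∑ᶠ p, homDual hW p (contraVal hW f) = f := by
  have hs : (Function.support fun p => homDual hW p (contraVal hW f)).Finite := by
    refine Set.Finite.subset (contraVal_mem hW f) fun p hp => ?_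
    by_contra hne
    refine hp (contraVal_injective hW ?_)
    ext x
    rw [homDual_apply, map_zero, LinearMap.zero_apply]
    by_contra h0
    exact hne ⟨_, dhProj_mem hW p x, h0⟩
  refine ⟨hs, contraVal_injective hW ?_⟩
  ext x
  have h := map_finsum (LinearMap.applyₗ x ∘ₗ contraVal hW) hs
  refine h.trans ?_
  have h' := map_finsum (contraVal hW f) (dhProj_finite hW x)
  rw [finsum_dhProj] at h'
  exact h'.symm

/-- Induction over homogeneous elements of the contragredient. -/
theorem contra_induction {P : (W.contragredient hW).carrier → Prop}
    (hom : ∀ p g, P (homDual hW p g)) (zero : P 0) (add : ∀ x y, P x → P y → P (x + y))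
    (f : (W.contragredient hW).carrier) : P f := by
  rw [← (finsum_homDual hW f).2]
  exact finsum_induction P zero add fun p => hom p _

/-- `W'' = W`. -/
theorem exists_eval (hW' : (W.contragredient hW).IsGeneralizedModule)
    (F : ((W.contragredient hW).contragredient hW').carrier) :
    ∃ x : W.carrier, ∀ f, contraVal hW' F f = contraVal hW f x := by
  -- Each homogeneous subspace is finite-dimensional, hence reflexive, so `F` is evaluation at a
  -- vector there.
  have key : ∀ p : G × ℂ, ∃ x ∈ W.gr p.1 ⊓ W.wt p.2, ∀ g,
      contraVal hW' F (homDual hW p g) = g x := by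
    intro p
    have := hW.gr_finite p.1 p.2
    obtain ⟨x, hx⟩ := (Module.evalEquiv ℂ ↥(W.gr p.1 ⊓ W.wt p.2)).surjective
      { toFun := fun g => contraVal hW' F (homDual hW p
          (g ∘ₗ (dhProj hW p).codRestrict (W.gr p.1 ⊓ W.wt p.2) (dhProj_mem hW p)))
        map_add' := fun g g' => by
          rw [← map_add]; rfl
        map_smul' := fun c g => by
          rw [RingHom.id_apply, ← map_smul]; rfl }
    refine ⟨x, x.2, fun g => ?_⟩
    have h := LinearMap.congr_fun hx (g ∘ₗ (W.gr p.1 ⊓ W.wt p.2).subtype)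
    rw [Module.evalEquiv_apply] at h
    change g x = contraVal hW' F _ at h
    rw [h]
    congr 1
    refine contraVal_injective hW ?_
    ext y
    simp only [homDual_apply, LinearMap.comp_apply, Submodule.subtype_apply,
      LinearMap.codRestrict_apply]
    rw [dhProj_same hW (dhProj_mem hW p y)]
  choose X hX hF using key
  -- If `X p ≠ 0`, then `F` is nonzero on the piece of `W'` of degree `-p.1` and weight `p.2`; there
  -- are finitely many such pieces.
  have hfin : {p : G × ℂ | X p ≠ 0}.Finite := by
    have h := contraVal_mem hW' F
    have hinj : Function.Injective fun p : G × ℂ => ((-p.1, p.2) : G × ℂ) := by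
      rintro ⟨a, b⟩ ⟨c, d⟩ h
      simpa using h
    refine (Set.Finite.preimage hinj.injOn h).subset fun p hp => ?_
    obtain ⟨g, hg⟩ : ∃ g : Module.Dual ℂ W.carrier, g (X p) ≠ 0 := by
      by_contra! hall
      exact hp ((Module.forall_dual_apply_eq_zero_iff ℂ _).1 hall)
    exact ⟨homDual hW p g, ⟨homDual_mem_gr hW p g, homDual_mem_wt hW p g⟩, by rwa [hF]⟩
  refine ⟨∑ᶠ p, X p, contra_induction hW (fun p g => ?_) (by simp) fun f f' h h' => by
    simp only [map_add, LinearMap.add_apply, h, h']⟩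
  rw [hF, map_finsum _ hfin, finsum_eq_single _ p fun q hq => ?_]
  · rw [homDual_apply, dhProj_same hW (hX p)]
  · rw [homDual_apply, dhProj_ne hW (hX q) hq.symm, map_zero]

end

/-! ## Weights of the modes -/

section

/-- `Shifts` controls `T` only on doubly homogeneous vectors. Passing to `T ∘ wtProj hW k` gives a
statement about all vectors, to which homogeneous induction applies. -/
theorem Shifts.wt {W : PreModule.{w} 𝒱} (hW : W.IsGeneralizedModule) {α : G} {s : ℂ}
    {T : Module.End ℂ W.carrier} (hT : T ∈ W.Shifts α s) {k : ℂ}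
    {x : W.carrier} (hx : x ∈ W.wt k) : T x ∈ W.wt (k + s) := by
  rw [← wtProj_same hW hx]
  refine dh_induction hW (P := fun x => T (wtProj hW k x) ∈ W.wt (k + s))
    (fun β n x hx => ?_) (by simp) (fun x y h h' => by simp only [map_add]; exact add_mem h h') x
  by_cases hn : k = n
  · subst hn
    rw [wtProj_same hW hx.2]
    exact (hT β k x hx).2
  · rw [wtProj_ne hW hx.2 hn, map_zero]
    exact zero_mem _

theorem L_wt {W : PreModule.{w} 𝒱} (hW : W.IsGeneralizedModule) 
    (j : SignType) {k : ℂ} {x : W.carrier} (hx : x ∈ W.wt k) :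
    W.L j x ∈ W.wt (k + -((j : ℤ) : ℂ)) :=
  Shifts.wt hW (L_shifts hW j) hx

/-- Here `v` has a weight but perhaps no `A`-degree; replacing `v` by `𝒱.proj h v` allows induction
over doubly homogeneous vectors of `V`. -/
theorem Y_wt {W : PreModule.{w} 𝒱} (hW : W.IsGeneralizedModule) 
    {h : ℤ} {v : V} (hv : v ∈ 𝒱.wt h) (n : ℤ) {k : ℂ} {x : W.carrier}
    (hx : x ∈ W.wt k) : W.Y v n x ∈ W.wt (k + (h - n - 1)) := by
  have e : 𝒱.proj h v = v := by rw [𝒱.proj_of_mem hv, if_pos rfl]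
  rw [← e]
  refine 𝒱.homogeneous_induction (P := fun v => W.Y (𝒱.proj h v) n x ∈ W.wt (k + (h - n - 1)))
    (fun α m v hv => ?_) (by simp)
    (fun x y h h' => by simp only [map_add, Pi.add_apply]; exact add_mem h h') v
  rw [𝒱.proj_of_mem hv.2]
  split_ifs with hm
  · subst hm
    exact Shifts.wt hW (Y_shifts hW hv n) hx
  · simp

theorem Yo_wt {W : PreModule.{w} 𝒱} (hW : W.IsGeneralizedModule) 
    {h : ℤ} {v : V} (hv : v ∈ 𝒱.wt h) (n : ℤ) {k : ℂ} {x : W.carrier}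
    (hx : x ∈ W.wt k) : W.Yo v n x ∈ W.wt (k + (n + 1 - h)) := by
  have e : 𝒱.proj h v = v := by rw [𝒱.proj_of_mem hv, if_pos rfl]
  rw [← e]
  refine 𝒱.homogeneous_induction (P := fun v => W.Yo (𝒱.proj h v) n x ∈ W.wt (k + (n + 1 - h)))
    (fun α m v hv => ?_) (by simp)
    (fun x y h h' => by simp only [map_add, Pi.add_apply]; exact add_mem h h') v
  rw [𝒱.proj_of_mem hv.2]
  split_ifs with hm
  · subst hm
    exact Shifts.wt hW (Yo_shifts hW hv n) hx
  · simp

end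

/-! ## The tensor product and its dual -/

section

variable {W₁ W₂ : PreModule.{w} 𝒱} (h₁ : W₁.IsGeneralizedModule) (h₂ : W₂.IsGeneralizedModule)
  (z : ℂ)

theorem tmul_mem_tensorGr {β γ : G} {w₁ : W₁.carrier} {w₂ : W₂.carrier} (hw₁ : w₁ ∈ W₁.gr β)
    (hw₂ : w₂ ∈ W₂.gr γ) : w₁ ⊗ₜ[ℂ] w₂ ∈ tensorGr W₁ W₂ (β + γ) :=
  Submodule.subset_span ⟨β, γ, rfl, w₁, hw₁, w₂, hw₂, rfl⟩

theorem tensor_induction (h₁ : W₁.IsGeneralizedModule) (h₂ : W₂.IsGeneralizedModule)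
    {P : W₁.carrier ⊗[ℂ] W₂.carrier → Prop}
    (hom : ∀ β γ, ∀ w₁ ∈ W₁.gr β, ∀ w₂ ∈ W₂.gr γ, P (w₁ ⊗ₜ w₂)) (zero : P 0)
    (add : ∀ s t, P s → P t → P (s + t)) (t : W₁.carrier ⊗[ℂ] W₂.carrier) : P t := by
  induction t with
  | zero => exact zero
  | add s t hs ht => exact add s t hs ht
  | tmul w₁ w₂ =>
    have hw₁ : w₁ ∈ ⨆ β, W₁.gr β := by rw [h₁.gr_top]; trivial
    have hw₂ : w₂ ∈ ⨆ β, W₂.gr β := by rw [h₂.gr_top]; trivial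
    refine Submodule.iSup_induction _ (motive := fun w₁ => P (w₁ ⊗ₜ w₂)) hw₁ (fun β w₁ hβ => ?_)
      (by rwa [TensorProduct.zero_tmul])
      fun x y hx hy => by rw [TensorProduct.add_tmul]; exact add _ _ hx hy
    exact Submodule.iSup_induction _ (motive := fun w₂ => P (w₁ ⊗ₜ w₂)) hw₂
      (fun γ w₂ hγ => hom β γ w₁ hβ w₂ hγ) (by rwa [TensorProduct.tmul_zero])
      fun x y hx hy => by rw [TensorProduct.tmul_add]; exact add _ _ hx hy

/-- An element of `(W₁ ⊗ W₂)^*` as a functional. -/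
def qEval : (qDual z h₁ h₂).carrier →ₗ[ℂ] Module.Dual ℂ (W₁.carrier ⊗[ℂ] W₂.carrier) :=
  LinearMap.id

theorem qEval_ext {l l' : (qDual z h₁ h₂).carrier}
    (h : ∀ w₁ w₂, qEval h₁ h₂ z l (w₁ ⊗ₜ w₂) = qEval h₁ h₂ z l' (w₁ ⊗ₜ w₂)) : l = l' :=
  TensorProduct.ext' (g := qEval h₁ h₂ z l) (h := qEval h₁ h₂ z l') h

theorem mem_qDual_gr {β : G} {l : (qDual z h₁ h₂).carrier} :
    l ∈ (qDual z h₁ h₂).gr β ↔ ∀ γ, γ ≠ -β → ∀ t ∈ tensorGr W₁ W₂ γ, qEval h₁ h₂ z l t = 0 := by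
  change qEval h₁ h₂ z l ∈ (⨅ γ : {γ : G // γ ≠ -β}, (tensorGr W₁ W₂ γ).dualAnnihilator) ↔ _
  simp only [Submodule.mem_iInf, Submodule.mem_dualAnnihilator, Subtype.forall]

/-- A functional of degree `β` is supported on tensors of degree `-β`. The full dual need not be the
sum of these subspaces, but their independence passes to stable subspaces such as the box. -/
theorem qDual_gr_indep : iSupIndep (qDual z h₁ h₂).gr := by
  classical
  rw [iSupIndep_iff_finsetSum_eq_zero_imp_eq_zero]
  intro s l hl hsum β hβ
  refine qEval_ext h₁ h₂ z fun w₁ w₂ => ?_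
  refine tensor_induction h₁ h₂ (P := fun t => qEval h₁ h₂ z (l β) t = qEval h₁ h₂ z 0 t)
    (fun γ δ w₁ hw₁ w₂ hw₂ => ?_) (by simp) (fun s t h h' => by simp only [map_add, h, h']) _
  have ht := tmul_mem_tensorGr hw₁ hw₂
  by_cases hne : γ + δ = -β
  · have h := LinearMap.congr_fun (congrArg (qEval h₁ h₂ z) hsum) (w₁ ⊗ₜ w₂)
    rw [map_sum, LinearMap.sum_apply, Finset.sum_eq_single_of_mem β hβ fun β' hβ' hb => ?_] at h
    · exact h
    · refine (mem_qDual_gr h₁ h₂ z).1 (hl β' hβ') _ (fun h => hb ?_) _ ht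
      rw [hne] at h
      exact (neg_injective h).symm
  · rw [(mem_qDual_gr h₁ h₂ z).1 (hl β hβ) _ hne _ ht, map_zero, LinearMap.zero_apply]

theorem qDual_L_apply (j : SignType) (l : (qDual z h₁ h₂).carrier) (w₁ : W₁.carrier)
    (w₂ : W₂.carrier) :
    qEval h₁ h₂ z ((qDual z h₁ h₂).L j l) (w₁ ⊗ₜ w₂) =
      (∑ i ∈ Finset.range ((j : ℤ) + 2).toNat, (binom ((j : ℤ) + 1) i * (-z) ^ i) •
        qEval h₁ h₂ z l (Lop W₁.L ((i : ℤ) - j) w₁ ⊗ₜ w₂))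
      - ∑ i ∈ Finset.range ((j : ℤ) + 2).toNat, (binom ((j : ℤ) + 1) i * (-z) ^ i) •
        qEval h₁ h₂ z l (w₁ ⊗ₜ Lop W₂.L ((j : ℤ) - i) w₂) := by
  change qEval h₁ h₂ z l ((∑ i ∈ Finset.range ((j : ℤ) + 2).toNat,
    (binom ((j : ℤ) + 1) i * (-z) ^ i) • ((Lop W₁.L ((i : ℤ) - j)).rTensor W₂.carrier -
      (Lop W₂.L ((j : ℤ) - i)).lTensor W₁.carrier)) (w₁ ⊗ₜ w₂)) = _
  rw [LinearMap.sum_apply, map_sum, ← Finset.sum_sub_distrib]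
  refine Finset.sum_congr rfl fun i _ => ?_
  simp only [LinearMap.smul_apply, LinearMap.sub_apply, LinearMap.rTensor_tmul,
    LinearMap.lTensor_tmul, map_smul, map_sub, smul_sub]

theorem left_finite (h₁ : W₁.IsGeneralizedModule) (v : V) (w₁ : W₁.carrier) (c : ℕ → ℂ) (m : ℤ) :
    (Function.support fun i : ℕ => c i • W₁.Yo v (m - i) w₁).Finite := by
  obtain ⟨N, hN⟩ := 𝒱.opp_truncated h₁.lowerTruncated v w₁
  refine (Set.finite_Iio (m - N).toNat).subset fun i hi => ?_
  by_contra hni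
  simp only [Set.mem_Iio, not_lt] at hni
  exact hi (by simp only [Yo]; rw [hN _ (by omega), smul_zero])

theorem right_finite (h₂ : W₂.IsGeneralizedModule) (v : V) (w₂ : W₂.carrier) (c : ℕ → ℂ) (m : ℤ) :
    (Function.support fun i : ℕ => c i • W₂.Y v (m + i) w₂).Finite := by
  obtain ⟨N, hN⟩ := h₂.lowerTruncated v w₂
  refine (Set.finite_Iio (N - m).toNat).subset fun i hi => ?_
  by_contra hni
  simp only [Set.mem_Iio, not_lt] at hni
  exact hi (by simp only []; rw [hN _ (by omega), smul_zero])

/-- The coefficients of `λ` applied to the right-hand side of the Jacobi identity for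
`Q(z)`-intertwining maps. -/
def jacobiRight (W₁ W₂ : PreModule.{w} 𝒱) (z : ℂ) {X : Type*} [AddCommGroup X] [Module ℂ X]
    (l : W₁.carrier ⊗[ℂ] W₂.carrier →ₗ[ℂ] X)
    (v : V) (w₁ : W₁.carrier) (w₂ : W₂.carrier) (m n : ℤ) : X :=
  (∑ᶠ i : ℕ, (binom m i * (-z) ^ i) • l (W₁.Yo v (m + n - i) w₁ ⊗ₜ w₂))
    - ∑ᶠ i : ℕ, (binom m i * (-z) ^ (m - i)) • l (w₁ ⊗ₜ W₂.Y v (n + i) w₂)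

/-- Truncation of `Y₁^o` and `Y₂` makes both sums finite before `l` is applied, so they commute with
any linear map. -/
theorem map_jacobiRight (h₁ : W₁.IsGeneralizedModule) (h₂ : W₂.IsGeneralizedModule) (z : ℂ)
    {X X' : Type*} [AddCommGroup X] [Module ℂ X] [AddCommGroup X']
    [Module ℂ X'] (l : W₁.carrier ⊗[ℂ] W₂.carrier →ₗ[ℂ] X)
    (φ : X →ₗ[ℂ] X') (v : V) (w₁ : W₁.carrier) (w₂ : W₂.carrier) (m n : ℤ) :
    φ (jacobiRight W₁ W₂ z l v w₁ w₂ m n) = jacobiRight W₁ W₂ z (φ ∘ₗ l) v w₁ w₂ m n := by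
  rw [jacobiRight, jacobiRight, map_sub, map_finsum φ, map_finsum φ]
  · simp only [map_smul, LinearMap.comp_apply]
  · refine (right_finite h₂ v w₂ (fun i => binom m i * (-z) ^ (m - i)) n).subset fun i hi h => hi ?_
    simp only at h ⊢
    rw [← map_smul, ← TensorProduct.tmul_smul, h, TensorProduct.tmul_zero, map_zero]
  · refine (left_finite h₁ v w₁ (fun i => binom m i * (-z) ^ i) (m + n)).subset fun i hi h => hi ?_
    simp only at h ⊢
    rw [← map_smul, TensorProduct.smul_tmul', h, TensorProduct.zero_tmul, map_zero]

/-- The case `n = 0` is the residue in `x₁`, which is how `Y'_{Q(z)}` is defined. -/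
theorem jacobiRight_zero (l : W₁.carrier ⊗[ℂ] W₂.carrier →ₗ[ℂ] ℂ) (v : V) (w₁ : W₁.carrier)
    (w₂ : W₂.carrier) (m : ℤ) :
    jacobiRight W₁ W₂ z l v w₁ w₂ m 0
      = l (qLeft z h₁ m v w₁ ⊗ₜ w₂) - l (w₁ ⊗ₜ qRight z h₂ m v w₂) := by
  have h := map_jacobiRight h₁ h₂ z LinearMap.id l v w₁ w₂ m 0
  rw [LinearMap.comp_id] at h
  rw [← h, ← map_sub]
  congr 1
  have e₁ := map_finsum ((TensorProduct.mk ℂ W₁.carrier W₂.carrier).flip w₂)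
    (left_finite h₁ v w₁ (fun i => binom m i * (-z) ^ i) m)
  have e₂ := map_finsum (TensorProduct.mk ℂ W₁.carrier W₂.carrier w₁)
    (right_finite h₂ v w₂ (fun i => binom m i * (-z) ^ (m - i)) 0)
  simp only [map_smul, LinearMap.flip_apply, TensorProduct.mk_apply,
    zero_add] at e₁ e₂
  simp only [jacobiRight, LinearMap.id_apply, add_zero, zero_add]
  rw [← e₁, ← e₂]
  rfl

theorem qDual_Y_apply (v : V) (m : ℤ) (l : (qDual z h₁ h₂).carrier) (w₁ : W₁.carrier)
    (w₂ : W₂.carrier) :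
    qEval h₁ h₂ z ((qDual z h₁ h₂).Y v m l) (w₁ ⊗ₜ w₂)
      = jacobiRight W₁ W₂ z (qEval h₁ h₂ z l) v w₁ w₂ m 0 := by
  rw [jacobiRight_zero h₁ h₂, ← map_sub]
  rfl

end

/-! ## The dual of a `Q(z)`-intertwining map -/

theorem completion_mem {X : PreModule.{w} 𝒱} (u : X.completion) (n : ℂ) : u.1 n ∈ X.wt n :=
  Submodule.mem_pi.1 u.2 n trivial

/-- The weight `n` component of an element of the completion. -/
def completionProj (X : PreModule.{w} 𝒱) (n : ℂ) : X.completion →ₗ[ℂ] X.carrier :=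
  LinearMap.proj n ∘ₗ X.completion.subtype

theorem pairing_of_wt {X : PreModule.{w} 𝒱} {f : Module.Dual ℂ X.carrier} {k : ℂ}
    (h : ∀ n, n ≠ k → ∀ x ∈ X.wt n, f x = 0) (u : X.completion) : X.pairing f u = f (u.1 k) :=
  finsum_eq_single _ k fun n hn => h n hn _ (completion_mem u n)

/-- The `i`-th term sees only the component of weight `k - (m + 1 - h) - i`, so truncation of `u`
suffices, whatever the operators are. -/
theorem jacobiLeft_finite {X : PreModule.{w} 𝒱} {u : X.completion}
    (hu : ∀ n : ℂ, ∃ M : ℕ, ∀ m : ℕ, M ≤ m → u.1 (n - m) = 0) (T : ℕ → Module.End ℂ X.carrier)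
    (c : ℕ → ℂ) (m h : ℤ) (k : ℂ) :
    (Function.support fun i : ℕ => c i • T i (u.1 (k - ((m : ℂ) + i + 1 - h)))).Finite := by
  obtain ⟨M, hM⟩ := hu (k - ((m : ℂ) + 1 - h))
  refine (Set.finite_Iio M).subset fun i hi => ?_
  by_contra hni
  simp only [Set.mem_Iio, not_lt] at hni
  have e : k - ((m : ℂ) + i + 1 - h) = k - ((m : ℂ) + 1 - h) - i := by ring
  exact hi (by simp only [e]; rw [hM i hni, map_zero, smul_zero])

theorem binom_zero_left {i : ℕ} (hi : i ≠ 0) : binom 0 i = 0 := by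
  rw [binom, Ring.choose_zero_pos ℤ (Nat.pos_of_ne_zero hi), Int.cast_zero]

section

variable {W₁ W₂ X : PreModule.{w} 𝒱} (h₁ : W₁.IsGeneralizedModule) (h₂ : W₂.IsGeneralizedModule)
  (hX : X.IsGeneralizedModule) {z : ℂ} {I : W₁.carrier ⊗[ℂ] W₂.carrier →ₗ[ℂ] X.completion}
  (hI : IsQIntertwining z I)

/-- The image of a homogeneous tensor lies in one `G`-degree, and `f` is nonzero on only finitely
many pairs of a degree and a weight. -/
theorem pairing_finite (h₁ : W₁.IsGeneralizedModule) (h₂ : W₂.IsGeneralizedModule)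
    (hI : IsQIntertwining z I) {f : Module.Dual ℂ X.carrier} (hf : f ∈ X.gradedDual)
    (t : W₁.carrier ⊗[ℂ] W₂.carrier) : (Function.support fun n => f ((I t).1 n)).Finite := by
  refine tensor_induction h₁ h₂ (P := fun t => (Function.support fun n => f ((I t).1 n)).Finite)
    (fun β γ w₁ hw₁ w₂ hw₂ => ?_) (by simp) (fun s t h h' => ?_) t
  · refine (Set.Finite.image Prod.snd hf).subset fun n hn => ?_
    exact ⟨(β + γ, n), ⟨_, ⟨hI.compatible β γ w₁ hw₁ w₂ hw₂ n, completion_mem _ n⟩, hn⟩, rfl⟩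
  · refine (h.union h').subset ?_
    simp only [map_add, Submodule.coe_add, Pi.add_apply]
    exact Function.support_add _ _

/-- The map `I' : X' → (W₁ ⊗ W₂)^*`, `I'(f) = ⟨f, I(·)⟩`. -/
def dualMap : (X.contragredient hX).carrier →ₗ[ℂ] (qDual z h₁ h₂).carrier where
  toFun f :=
    ({ toFun := fun t => X.pairing (contraVal hX f) (I t)
       map_add' := fun s t => by
        simp only [pairing, map_add, Submodule.coe_add, Pi.add_apply]
        exact finsum_add_distrib (pairing_finite h₁ h₂ hI (contraVal_mem hX f) s)
          (pairing_finite h₁ h₂ hI (contraVal_mem hX f) t)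
       map_smul' := fun c t => by
        simp only [pairing, map_smul, SetLike.val_smul, Pi.smul_apply, RingHom.id_apply]
        exact (smul_finsum' c (pairing_finite h₁ h₂ hI (contraVal_mem hX f) t)).symm } :
      Module.Dual ℂ (W₁.carrier ⊗[ℂ] W₂.carrier))
  map_add' f g := LinearMap.ext fun t => by
    change X.pairing (contraVal hX (f + g)) (I t)
      = X.pairing (contraVal hX f) (I t) + X.pairing (contraVal hX g) (I t)
    simp only [pairing, map_add, LinearMap.add_apply]
    exact finsum_add_distrib (pairing_finite h₁ h₂ hI (contraVal_mem hX f) t)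
      (pairing_finite h₁ h₂ hI (contraVal_mem hX g) t)
  map_smul' c f := LinearMap.ext fun t => by
    change X.pairing (contraVal hX (c • f)) (I t) = c • X.pairing (contraVal hX f) (I t)
    simp only [pairing, map_smul, LinearMap.smul_apply]
    exact (smul_finsum' c (pairing_finite h₁ h₂ hI (contraVal_mem hX f) t)).symm

theorem dualMap_apply (f : (X.contragredient hX).carrier) (t : W₁.carrier ⊗[ℂ] W₂.carrier) :
    qEval h₁ h₂ z (dualMap h₁ h₂ hX hI f) t = X.pairing (contraVal hX f) (I t) := rfl

theorem dualMap_of_wt {f : (X.contragredient hX).carrier} {k : ℂ}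
    (h : ∀ n, n ≠ k → ∀ x ∈ X.wt n, contraVal hX f x = 0) (t : W₁.carrier ⊗[ℂ] W₂.carrier) :
    qEval h₁ h₂ z (dualMap h₁ h₂ hX hI f) t = contraVal hX f ((I t).1 k) := by
  rw [dualMap_apply, pairing_of_wt h]

theorem dualMap_L (j : SignType) (f : (X.contragredient hX).carrier) :
    dualMap h₁ h₂ hX hI ((X.contragredient hX).L j f)
      = (qDual z h₁ h₂).L j (dualMap h₁ h₂ hX hI f) := by
  refine contra_induction hX (P := fun f => dualMap h₁ h₂ hX hI ((X.contragredient hX).L j f)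
      = (qDual z h₁ h₂).L j (dualMap h₁ h₂ hX hI f)) (fun p g => qEval_ext h₁ h₂ z fun w₁ w₂ => ?_)
      (by simp only [map_zero]) (fun x y h h' => by simp only [map_add, h, h']) f
  have hf := fun n (hn : n ≠ p.2) x hx => homDual_apply_of_ne hX hn g (x := x) hx
  -- `L(-j)` raises weights by `j`, so `f ∘ L(-j)` detects only the component of weight `p.2 - j`.
  rw [dualMap_of_wt h₁ h₂ hX hI (k := p.2 - ((j : ℤ) : ℂ)), contra_L_apply, hI.sl2, map_sub,
    map_sum, map_sum, qDual_L_apply]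
  · simp only [map_smul, dualMap_of_wt h₁ h₂ hX hI hf]
  · intro n hn x hx
    have h := L_wt hX (-j) hx
    rw [contra_L_apply]
    refine homDual_apply_of_ne hX (fun h => hn ?_) g h
    rw [← h]
    push_cast
    ring

/-- For `f` concentrated in weight `k`, the pairing with `I(t)` is `f` of the weight `k` component;
applying `f` to that component of the Jacobi identity gives the claim. -/
theorem dualMap_jacobi {h : ℤ} {v : V} (hv : v ∈ 𝒱.wt h) {f : (X.contragredient hX).carrier}
    {k : ℂ} (hf : ∀ n, n ≠ k → ∀ x ∈ X.wt n, contraVal hX f x = 0) (w₁ : W₁.carrier)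
    (w₂ : W₂.carrier) (m n : ℤ) :
    (Function.support fun i : ℕ => (binom n i * z ^ (n - i)) • contraVal hX f
        (X.Yo v (m + i) ((I (w₁ ⊗ₜ w₂)).1 (k - ((m : ℂ) + i + 1 - h))))).Finite ∧
      ∑ᶠ i : ℕ, (binom n i * z ^ (n - i)) • contraVal hX f
        (X.Yo v (m + i) ((I (w₁ ⊗ₜ w₂)).1 (k - ((m : ℂ) + i + 1 - h))))
      = jacobiRight W₁ W₂ z (qEval h₁ h₂ z (dualMap h₁ h₂ hX hI f)) v w₁ w₂ m n := by
  have hfin := jacobiLeft_finite (hI.lowerTruncated w₁ w₂) (fun i => X.Yo v (m + i))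
    (fun i => binom n i * z ^ (n - i)) m h k
  have hj : _ = jacobiRight W₁ W₂ z (X.completionProj k ∘ₗ I) v w₁ w₂ m n :=
    hI.jacobi h v hv w₁ w₂ m n k
  have e : contraVal hX f ∘ₗ X.completionProj k ∘ₗ I = qEval h₁ h₂ z (dualMap h₁ h₂ hX hI f) :=
    LinearMap.ext fun t => (dualMap_of_wt h₁ h₂ hX hI hf t).symm
  have hj' := congrArg (contraVal hX f) hj
  rw [map_jacobiRight h₁ h₂, e, map_finsum _ hfin] at hj'
  simp only [map_smul] at hj'
  refine ⟨hfin.subset fun i hi h0 => hi ?_, hj'⟩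
  simp only at h0 ⊢
  rw [← map_smul, h0, map_zero]

theorem dualMap_Y_of_wt {h : ℤ} {v : V} (hv : v ∈ 𝒱.wt h) {f : (X.contragredient hX).carrier}
    {k : ℂ} (hf : ∀ n, n ≠ k → ∀ x ∈ X.wt n, contraVal hX f x = 0) (m : ℤ)
    (t : W₁.carrier ⊗[ℂ] W₂.carrier) :
    qEval h₁ h₂ z (dualMap h₁ h₂ hX hI ((X.contragredient hX).Y v m f)) t
      = contraVal hX f (X.Yo v m ((I t).1 (k - ((m : ℂ) + 1 - h)))) := by
  rw [dualMap_of_wt h₁ h₂ hX hI (k := k - ((m : ℂ) + 1 - h)), contra_Y_apply]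
  intro n hn x hx
  refine hf _ (fun h => hn ?_) _ (Yo_wt hX hv m hx)
  rw [← h]
  ring

/-- At `n = 0` the factor `(z + x₀)^n` is `1`, so one term remains on the left of the Jacobi
identity, while the right side defines `Y'_{Q(z)}`. -/
theorem dualMap_Y (v : V) (m : ℤ) (f : (X.contragredient hX).carrier) :
    dualMap h₁ h₂ hX hI ((X.contragredient hX).Y v m f)
      = (qDual z h₁ h₂).Y v m (dualMap h₁ h₂ hX hI f) := by
  refine 𝒱.homogeneous_induction (P := fun v => dualMap h₁ h₂ hX hI ((X.contragredient hX).Y v m f)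
      = (qDual z h₁ h₂).Y v m (dualMap h₁ h₂ hX hI f)) (fun α h v hv => ?_)
      (by simp only [map_zero, Pi.zero_apply, LinearMap.zero_apply])
      (fun x y h h' => by simp only [map_add, Pi.add_apply, LinearMap.add_apply, h, h']) v
  refine contra_induction hX (P := fun f => dualMap h₁ h₂ hX hI ((X.contragredient hX).Y v m f)
      = (qDual z h₁ h₂).Y v m (dualMap h₁ h₂ hX hI f))
      (fun p g => qEval_ext h₁ h₂ z fun w₁ w₂ => ?_)
      (by simp only [map_zero]) (fun x y h h' => by simp only [map_add, h, h']) f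
  have hf := fun n (hn : n ≠ p.2) x hx => homDual_apply_of_ne hX hn g (x := x) hx
  rw [qDual_Y_apply, dualMap_Y_of_wt h₁ h₂ hX hI hv.2 hf,
    ← (dualMap_jacobi h₁ h₂ hX hI hv.2 hf w₁ w₂ m 0).2, finsum_eq_single _ 0 fun i hi => ?_]
  · simp [binom]
  · rw [binom_zero_left hi, zero_mul, zero_smul]

theorem dualMap_gr {β : G} {f : (X.contragredient hX).carrier}
    (hf : f ∈ (X.contragredient hX).gr β) : dualMap h₁ h₂ hX hI f ∈ (qDual z h₁ h₂).gr β := by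
  rw [mem_contra_gr] at hf
  rw [mem_qDual_gr]
  intro γ hγ t ht
  refine Submodule.span_induction (fun t ht => ?_) (map_zero _)
    (fun s t _ _ h h' => by rw [map_add, h, h', add_zero])
    (fun c t _ h => by rw [map_smul, h, smul_zero]) ht
  obtain ⟨δ, ε, rfl, w₁, hw₁, w₂, hw₂, rfl⟩ := ht
  rw [dualMap_apply, pairing]
  exact finsum_eq_zero_of_forall_eq_zero fun n =>
    hf _ hγ _ (hI.compatible δ ε w₁ hw₁ w₂ hw₂ n)

/-- The map `I' : X' → (W₁ ⊗ W₂)^*` as a map of modules. -/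
def dualHom : Hom (X.contragredient hX) (qDual z h₁ h₂) where
  toLinearMap := dualMap h₁ h₂ hX hI
  map_Y := dualMap_Y h₁ h₂ hX hI
  map_L := dualMap_L h₁ h₂ hX hI
  map_gr _ _ hf := dualMap_gr h₁ h₂ hX hI hf

/-- The Jacobi identity for `Y'_{Q(z)}` acting on `λ`: the `Q(z)`-compatibility condition. -/
def Compatible (l : (qDual z h₁ h₂).carrier) : Prop :=
  ∀ (h : ℤ), ∀ v ∈ 𝒱.wt h, ∀ w₁ w₂ (m n : ℤ),
    (Function.support fun i : ℕ => (binom n i * z ^ (n - i)) •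
      qEval h₁ h₂ z ((qDual z h₁ h₂).Y v (m + i) l) (w₁ ⊗ₜ w₂)).Finite ∧
    ∑ᶠ i : ℕ, (binom n i * z ^ (n - i)) •
      qEval h₁ h₂ z ((qDual z h₁ h₂).Y v (m + i) l) (w₁ ⊗ₜ w₂)
    = jacobiRight W₁ W₂ z (qEval h₁ h₂ z l) v w₁ w₂ m n

theorem Compatible.add {l l' : (qDual z h₁ h₂).carrier} (hl : Compatible h₁ h₂ l)
    (hl' : Compatible h₁ h₂ l') : Compatible h₁ h₂ (l + l') := by
  intro h v hv w₁ w₂ m n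
  obtain ⟨f, e⟩ := hl h v hv w₁ w₂ m n
  obtain ⟨f', e'⟩ := hl' h v hv w₁ w₂ m n
  simp only [map_add, LinearMap.add_apply, smul_add]
  refine ⟨(f.union f').subset (Function.support_add _ _), ?_⟩
  -- Additivity in the functional becomes visible once `jacobiRight` is written as the functional
  -- applied to the tensor `jacobiRight` of the identity.
  rw [finsum_add_distrib f f', e, e', ← LinearMap.comp_id (qEval h₁ h₂ z l + qEval h₁ h₂ z l'),
    ← map_jacobiRight h₁ h₂, LinearMap.add_apply, map_jacobiRight h₁ h₂, map_jacobiRight h₁ h₂,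
    LinearMap.comp_id, LinearMap.comp_id]

theorem dualMap_compatible (f : (X.contragredient hX).carrier) :
    Compatible h₁ h₂ (dualMap h₁ h₂ hX hI f) := by
  refine contra_induction hX (P := fun f => Compatible h₁ h₂ (dualMap h₁ h₂ hX hI f))
    (fun p g h v hv w₁ w₂ m n => ?_) ?_ (fun x y h h' => ?_) f
  · have hf := fun n (hn : n ≠ p.2) x hx => homDual_apply_of_ne hX hn g (x := x) hx
    have key := dualMap_jacobi h₁ h₂ hX hI hv hf w₁ w₂ m n
    simp only [← dualMap_Y, dualMap_Y_of_wt h₁ h₂ hX hI hv hf]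
    push_cast
    exact key
  · rw [map_zero]
    intro h v hv w₁ w₂ m n
    simp [jacobiRight]
  · rw [map_add]
    exact h.add h₁ h₂ h'

end

/-! ## Direct sums of `Q(z)`-products -/

section

variable (W X : PreModule.{w} 𝒱)

theorem map_sub_pow {W X : PreModule.{w} 𝒱} {φ : W.carrier →ₗ[ℂ] X.carrier}
    (h : ∀ x, φ (W.L 0 x) = X.L 0 (φ x)) (n : ℂ) (N : ℕ) (x : W.carrier) :
    φ (((W.L 0 - n • (1 : Module.End ℂ W.carrier)) ^ N) x)
      = ((X.L 0 - n • (1 : Module.End ℂ X.carrier)) ^ N) (φ x) := by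
  induction N generalizing x with
  | zero => rfl
  | succ N ih =>
    rw [pow_succ, pow_succ, Module.End.mul_apply, Module.End.mul_apply, ih]
    simp only [LinearMap.sub_apply, LinearMap.smul_apply, Module.End.one_apply, map_sub, map_smul,
      h]

theorem map_mem_wt {W X : PreModule.{w} 𝒱} {φ : W.carrier →ₗ[ℂ] X.carrier}
    (h : ∀ x, φ (W.L 0 x) = X.L 0 (φ x)) {n : ℂ} {x : W.carrier} (hx : x ∈ W.wt n) :
    φ x ∈ X.wt n := by
  rw [wt, Module.End.mem_maxGenEigenspace] at hx ⊢
  obtain ⟨N, hN⟩ := hx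
  exact ⟨N, by rw [← map_sub_pow h, hN, map_zero]⟩

/-- The first projection of a direct sum. -/
def directSumFst : (W.directSum X).carrier →ₗ[ℂ] W.carrier := LinearMap.fst ℂ W.carrier X.carrier

/-- The second projection of a direct sum. -/
def directSumSnd : (W.directSum X).carrier →ₗ[ℂ] X.carrier := LinearMap.snd ℂ W.carrier X.carrier

variable {W X}

theorem directSum_ext {x y : (W.directSum X).carrier} (h : directSumFst W X x = directSumFst W X y)
    (h' : directSumSnd W X x = directSumSnd W X y) : x = y :=
  Prod.ext (α := W.carrier) (β := X.carrier) h h'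

theorem mem_directSum_wt {n : ℂ} {x : (W.directSum X).carrier} :
    x ∈ (W.directSum X).wt n ↔ directSumFst W X x ∈ W.wt n ∧ directSumSnd W X x ∈ X.wt n := by
  have h₁ := map_sub_pow (φ := directSumFst W X) fun _ => rfl
  have h₂ := map_sub_pow (φ := directSumSnd W X) fun _ => rfl
  refine ⟨fun hx => ⟨map_mem_wt (φ := directSumFst W X) (fun _ => rfl) hx,
    map_mem_wt (φ := directSumSnd W X) (fun _ => rfl) hx⟩, ?_⟩
  rw [wt, wt, wt, Module.End.mem_maxGenEigenspace, Module.End.mem_maxGenEigenspace,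
    Module.End.mem_maxGenEigenspace]
  rintro ⟨⟨N, hN⟩, ⟨M, hM⟩⟩
  refine ⟨N + M, directSum_ext ?_ ?_⟩
  · rw [h₁, map_zero, add_comm, pow_add, Module.End.mul_apply, hN, map_zero]
  · rw [h₂, map_zero, pow_add, Module.End.mul_apply, hM, map_zero]

theorem directSum_Yo_fst (v : V) (n : ℤ) (x : (W.directSum X).carrier) :
    directSumFst W X ((W.directSum X).Yo v n x) = W.Yo v n (directSumFst W X x) :=
  𝒱.opp_congr (directSumFst W X ∘ₗ LinearMap.applyₗ x) (LinearMap.applyₗ (directSumFst W X x))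
    (fun _ _ => rfl) v n

theorem directSum_Yo_snd (v : V) (n : ℤ) (x : (W.directSum X).carrier) :
    directSumSnd W X ((W.directSum X).Yo v n x) = X.Yo v n (directSumSnd W X x) :=
  𝒱.opp_congr (directSumSnd W X ∘ₗ LinearMap.applyₗ x) (LinearMap.applyₗ (directSumSnd W X x))
    (fun _ _ => rfl) v n

variable {W₁ W₂ : PreModule.{w} 𝒱} {z : ℂ}

/-- The map `(I, J)` into the completion of a direct sum. -/
def prodIntertwining (I : W₁.carrier ⊗[ℂ] W₂.carrier →ₗ[ℂ] W.completion)
    (J : W₁.carrier ⊗[ℂ] W₂.carrier →ₗ[ℂ] X.completion) :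
    W₁.carrier ⊗[ℂ] W₂.carrier →ₗ[ℂ] (W.directSum X).completion where
  toFun t := ⟨fun n => ((I t).1 n, (J t).1 n), Submodule.mem_pi.2 fun n _ =>
    mem_directSum_wt.2 ⟨completion_mem _ n, completion_mem _ n⟩⟩
  map_add' s t := Subtype.ext <| funext fun n => by
    refine directSum_ext ?_ ?_
    · exact congrArg (fun u : W.completion => u.1 n) (map_add I s t)
    · exact congrArg (fun u : X.completion => u.1 n) (map_add J s t)
  map_smul' c t := Subtype.ext <| funext fun n => by
    refine directSum_ext ?_ ?_
    · exact congrArg (fun u : W.completion => u.1 n) (map_smul I c t)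
    · exact congrArg (fun u : X.completion => u.1 n) (map_smul J c t)

theorem prodIntertwining_fst (I : W₁.carrier ⊗[ℂ] W₂.carrier →ₗ[ℂ] W.completion)
    (J : W₁.carrier ⊗[ℂ] W₂.carrier →ₗ[ℂ] X.completion) (t : W₁.carrier ⊗[ℂ] W₂.carrier) (n : ℂ) :
    directSumFst W X ((prodIntertwining I J t).1 n) = (I t).1 n := rfl

theorem prodIntertwining_snd (I : W₁.carrier ⊗[ℂ] W₂.carrier →ₗ[ℂ] W.completion)
    (J : W₁.carrier ⊗[ℂ] W₂.carrier →ₗ[ℂ] X.completion) (t : W₁.carrier ⊗[ℂ] W₂.carrier) (n : ℂ) :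
    directSumSnd W X ((prodIntertwining I J t).1 n) = (J t).1 n := rfl

/-- Every condition is checked on the two components, because the projections commute with all
actions, `Y^o` included. -/
theorem isQIntertwining_prod (h₁ : W₁.IsGeneralizedModule) (h₂ : W₂.IsGeneralizedModule)
    {I : W₁.carrier ⊗[ℂ] W₂.carrier →ₗ[ℂ] W.completion}
    {J : W₁.carrier ⊗[ℂ] W₂.carrier →ₗ[ℂ] X.completion} (hI : IsQIntertwining z I)
    (hJ : IsQIntertwining z J) : IsQIntertwining z (prodIntertwining I J) := by
  have htr : ∀ w₁ w₂ (n : ℂ), ∃ M : ℕ, ∀ m : ℕ, M ≤ m →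
      (prodIntertwining I J (w₁ ⊗ₜ w₂)).1 (n - m) = 0 := by
    intro w₁ w₂ n
    obtain ⟨M, hM⟩ := hI.lowerTruncated w₁ w₂ n
    obtain ⟨N, hN⟩ := hJ.lowerTruncated w₁ w₂ n
    refine ⟨max M N, fun m hm => directSum_ext ?_ ?_⟩
    · rw [prodIntertwining_fst, map_zero, hM m (le_trans (le_max_left _ _) hm)]
    · rw [prodIntertwining_snd, map_zero, hN m (le_trans (le_max_right _ _) hm)]
  refine ⟨fun β γ w₁ hw₁ w₂ hw₂ n => ⟨hI.compatible β γ w₁ hw₁ w₂ hw₂ n,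
    hJ.compatible β γ w₁ hw₁ w₂ hw₂ n⟩, htr, fun h v hv w₁ w₂ m n k => ?_,
    fun j w₁ w₂ k => ?_⟩
  · have hfin := jacobiLeft_finite (htr w₁ w₂) (fun i => (W.directSum X).Yo v (m + i))
      (fun i => binom n i * z ^ (n - i)) m h k
    change _ = jacobiRight W₁ W₂ z
      ((W.directSum X).completionProj k ∘ₗ prodIntertwining I J) v w₁ w₂ m n
    refine directSum_ext ?_ ?_
    · rw [map_jacobiRight h₁ h₂, map_finsum _ hfin]
      simp only [map_smul, directSum_Yo_fst, prodIntertwining_fst]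
      exact hI.jacobi h v hv w₁ w₂ m n k
    · rw [map_jacobiRight h₁ h₂, map_finsum _ hfin]
      simp only [map_smul, directSum_Yo_snd, prodIntertwining_snd]
      exact hJ.jacobi h v hv w₁ w₂ m n k
  · refine directSum_ext ?_ ?_
    · simp only [map_sub, map_sum, map_smul, prodIntertwining_fst]
      exact hI.sl2 j w₁ w₂ k
    · simp only [map_sub, map_sum, map_smul, prodIntertwining_snd]
      exact hJ.sl2 j w₁ w₂ k

theorem isQIntertwining_zero :
    IsQIntertwining z (0 : W₁.carrier ⊗[ℂ] W₂.carrier →ₗ[ℂ] X.completion) := by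
  refine ⟨fun _ _ _ _ _ _ _ => zero_mem _, fun _ _ _ => ⟨0, fun _ _ => rfl⟩,
    fun h v hv w₁ w₂ m n k => ?_, fun j w₁ w₂ k => ?_⟩ <;>
  simp

theorem prod_mem_gradedDual {f : Module.Dual ℂ W.carrier} (hf : f ∈ W.gradedDual)
    {g : Module.Dual ℂ X.carrier} (hg : g ∈ X.gradedDual) :
    f ∘ₗ directSumFst W X + g ∘ₗ directSumSnd W X ∈ (W.directSum X).gradedDual := by
  refine (Set.Finite.union hf hg).subset ?_
  rintro p ⟨⟨x, y⟩, hx, hne⟩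
  have hwt := mem_directSum_wt.1 hx.2
  by_cases h0 : f x = 0
  · refine Or.inr ⟨y, ⟨hx.1.2, hwt.2⟩, fun h1 => hne ?_⟩
    change f x + g y = 0
    rw [h0, h1, add_zero]
  · exact Or.inl ⟨x, ⟨hx.1.1, hwt.1⟩, h0⟩

end

end PreModule

/-! ## The subspace `box` -/

section

variable (𝒞 : ModuleCategory.{w} 𝒱) (z : ℂ) {W₁ W₂ : PreModule.{w} 𝒱} (h₁ : 𝒞.Obj W₁)
  (h₂ : 𝒞.Obj W₂)

open PreModule

theorem box_eq_boxSet (h₁ : 𝒞.Obj W₁) (h₂ : 𝒞.Obj W₂) :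
    (box 𝒞 z W₁ W₂ : Set (Module.Dual ℂ (W₁.carrier ⊗[ℂ] W₂.carrier))) = boxSet 𝒞 z W₁ W₂ := by
  let S : Submodule ℂ (Module.Dual ℂ (W₁.carrier ⊗[ℂ] W₂.carrier)) :=
    { carrier := boxSet 𝒞 z W₁ W₂
      -- Any object of `𝒞` with the zero map would do; `W₁` is at hand.
      zero_mem' := ⟨W₁, h₁, 0, isQIntertwining_zero, 0, zero_mem _, fun t => by simp [pairing]⟩
      add_mem' := by
        rintro l l' ⟨W, hW, I, hI, f, hf, hl⟩ ⟨X, hX, J, hJ, g, hg, hl'⟩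
        refine ⟨_, 𝒞.directSum hW hX, prodIntertwining I J,
          isQIntertwining_prod (𝒞.isModule h₁) (𝒞.isModule h₂) hI hJ, _,
          prod_mem_gradedDual hf hg, fun t => ?_⟩
        rw [LinearMap.add_apply, hl, hl']
        exact (finsum_add_distrib (pairing_finite (𝒞.isModule h₁) (𝒞.isModule h₂) hI hf t)
          (pairing_finite (𝒞.isModule h₁) (𝒞.isModule h₂) hJ hg t)).symm
      smul_mem' := by
        rintro c l ⟨W, hW, I, hI, f, hf, hl⟩
        refine ⟨W, hW, I, hI, c • f, Submodule.smul_mem _ c hf, fun t => ?_⟩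
        rw [LinearMap.smul_apply, hl]
        exact smul_finsum' c (pairing_finite (𝒞.isModule h₁) (𝒞.isModule h₂) hI hf t) }
  exact congrArg SetLike.coe (Submodule.span_eq S)

theorem mem_box_iff {l : (qDual z (𝒞.isModule h₁) (𝒞.isModule h₂)).carrier} :
    qEval (𝒞.isModule h₁) (𝒞.isModule h₂) z l ∈ box 𝒞 z W₁ W₂ ↔
      ∃ (W : PreModule.{w} 𝒱) (hW : 𝒞.Obj W)
        (I : W₁.carrier ⊗[ℂ] W₂.carrier →ₗ[ℂ] W.completion) (hI : IsQIntertwining z I)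
        (f : (W.contragredient (𝒞.isModule hW)).carrier),
        l = dualMap (𝒞.isModule h₁) (𝒞.isModule h₂) (𝒞.isModule hW) hI f := by
  rw [← SetLike.mem_coe, box_eq_boxSet 𝒞 z h₁ h₂]
  constructor
  · rintro ⟨W, hW, I, hI, f, hf, hl⟩
    exact ⟨W, hW, I, hI, contraMk (𝒞.isModule hW) f hf, LinearMap.ext hl⟩
  · rintro ⟨W, hW, I, hI, f, rfl⟩
    exact ⟨W, hW, I, hI, _, contraVal_mem _ f, fun t => rfl⟩

theorem box_stable : (qDual z (𝒞.isModule h₁) (𝒞.isModule h₂)).Stable (box 𝒞 z W₁ W₂) := by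
  refine ⟨fun v n l hl => ?_, fun j l hl => ?_⟩
  · obtain ⟨W, hW, I, hI, f, rfl⟩ := (mem_box_iff 𝒞 z h₁ h₂).1 hl
    exact (mem_box_iff 𝒞 z h₁ h₂).2 ⟨W, hW, I, hI, _, (dualMap_Y _ _ _ hI v n f).symm⟩
  · obtain ⟨W, hW, I, hI, f, rfl⟩ := (mem_box_iff 𝒞 z h₁ h₂).1 hl
    exact (mem_box_iff 𝒞 z h₁ h₂).2 ⟨W, hW, I, hI, _, (dualMap_L _ _ _ hI j f).symm⟩

theorem box_compatible {l : (qDual z (𝒞.isModule h₁) (𝒞.isModule h₂)).carrier}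
    (hl : qEval (𝒞.isModule h₁) (𝒞.isModule h₂) z l ∈ box 𝒞 z W₁ W₂) :
    Compatible (𝒞.isModule h₁) (𝒞.isModule h₂) l := by
  obtain ⟨W, hW, I, hI, f, rfl⟩ := (mem_box_iff 𝒞 z h₁ h₂).1 hl
  exact dualMap_compatible _ _ _ hI f

end

namespace PreModule

/-! ## Maps of modules and their transposes -/

section

variable {M N : PreModule.{w} 𝒱}

theorem Hom.map_wt (φ : Hom M N) {n : ℂ} {x : M.carrier} (hx : x ∈ M.wt n) :
    φ.toLinearMap x ∈ N.wt n :=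
  map_mem_wt (φ.map_L 0) hx

theorem Hom.map_Yo (φ : Hom M N) (v : V) (n : ℤ) (x : M.carrier) :
    φ.toLinearMap (M.Yo v n x) = N.Yo v n (φ.toLinearMap x) :=
  𝒱.opp_congr (φ.toLinearMap ∘ₗ LinearMap.applyₗ x) (LinearMap.applyₗ (φ.toLinearMap x))
    (fun v n => φ.map_Y v n x) v n

variable (hM : M.IsGeneralizedModule) (hN : N.IsGeneralizedModule)

theorem Hom.comp_mem_gradedDual (φ : Hom M N) {f : Module.Dual ℂ N.carrier}
    (hf : f ∈ N.gradedDual) : f ∘ₗ φ.toLinearMap ∈ M.gradedDual :=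
  Set.Finite.subset hf fun _ ⟨x, hx, hne⟩ =>
    ⟨φ.toLinearMap x, ⟨φ.map_gr _ x hx.1, φ.map_wt hx.2⟩, hne⟩

/-- The transpose `N' → M'` of a map `M → N`. -/
def Hom.transpose (φ : Hom M N) : Hom (N.contragredient hN) (M.contragredient hM) where
  toLinearMap :=
    { toFun := fun f => contraMk hM (contraVal hN f ∘ₗ φ.toLinearMap)
        (φ.comp_mem_gradedDual (contraVal_mem hN f))
      map_add' := fun _ _ => rfl
      map_smul' := fun _ _ => rfl }
  map_Y v n f := contraVal_injective hM <| LinearMap.ext fun x => by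
    change contraVal hN f (N.Yo v n (φ.toLinearMap x))
      = contraVal hN f (φ.toLinearMap (M.Yo v n x))
    rw [φ.map_Yo]
  map_L j f := contraVal_injective hM <| LinearMap.ext fun x => by
    change contraVal hN f (N.L (-j) (φ.toLinearMap x))
      = contraVal hN f (φ.toLinearMap (M.L (-j) x))
    rw [φ.map_L]
  map_gr β f hf := by
    rw [mem_contra_gr] at hf ⊢
    exact fun γ hγ x hx => hf γ hγ _ (φ.map_gr γ x hx)

theorem Hom.transpose_apply (φ : Hom M N) (f : (N.contragredient hN).carrier) (x : M.carrier) :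
    contraVal hM ((φ.transpose hM hN).toLinearMap f) x = contraVal hN f (φ.toLinearMap x) := rfl

/-- The composition of two maps. -/
def Hom.comp {P : PreModule.{w} 𝒱} (ψ : Hom N P) (φ : Hom M N) : Hom M P where
  toLinearMap := ψ.toLinearMap ∘ₗ φ.toLinearMap
  map_Y v n x := by simp only [LinearMap.comp_apply, φ.map_Y, ψ.map_Y]
  map_L j x := by simp only [LinearMap.comp_apply, φ.map_L, ψ.map_L]
  map_gr β x hx := ψ.map_gr β _ (φ.map_gr β x hx)

variable (hM' : (M.contragredient hM).IsGeneralizedModule)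

/-- The element of `M` that corresponds to an element of `M''`. -/
def bidualFun (F : ((M.contragredient hM).contragredient hM').carrier) : M.carrier :=
  (exists_eval hM hM' F).choose

theorem bidualFun_spec (F : ((M.contragredient hM).contragredient hM').carrier)
    (f : (M.contragredient hM).carrier) :
    contraVal hM f (bidualFun hM hM' F) = contraVal hM' F f :=
  ((exists_eval hM hM' F).choose_spec f).symm

/-- The canonical map `M'' → M`. -/
def bidualHom : Hom ((M.contragredient hM).contragredient hM') M where
  toLinearMap :=
    { toFun := bidualFun hM hM'
      map_add' := fun F F' => eq_of_homDual hM fun p g => by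
        simp only [map_add, bidualFun_spec, LinearMap.add_apply]
      map_smul' := fun c F => eq_of_homDual hM fun p g => by
        simp only [map_smul, bidualFun_spec, LinearMap.smul_apply, RingHom.id_apply] }
  map_Y v n F := eq_of_homDual hM fun p g => by
    simp only [LinearMap.coe_mk, AddHom.coe_mk]
    rw [bidualFun_spec, contra_Y_apply, ← bidualFun_spec, contra_Yo_apply]
  map_L j F := eq_of_homDual hM fun p g => by
    simp only [LinearMap.coe_mk, AddHom.coe_mk]
    rw [bidualFun_spec, contra_L_apply, ← bidualFun_spec, contra_L_apply, neg_neg]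
  map_gr β F hF := by
    simp only [LinearMap.coe_mk, AddHom.coe_mk]
    rw [mem_contra_gr] at hF
    -- Components of degree other than `β` vanish, because `F` kills the functionals of degree
    -- `-p.1` when `p.1 ≠ β`.
    rw [← finsum_dhProj hM (bidualFun hM hM' F)]
    refine finsum_induction (· ∈ M.gr β) (zero_mem _) (fun _ _ => add_mem) fun p => ?_
    by_cases hp : p.1 = β
    · exact hp ▸ (dhProj_mem hM p _).1
    · have h0 : dhProj hM p (bidualFun hM hM' F) = 0 := by
        rw [← Module.forall_dual_apply_eq_zero_iff ℂ]
        intro g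
        rw [← homDual_apply hM p g, bidualFun_spec]
        exact hF _ (fun h => hp (neg_injective h)) _ (homDual_mem_gr hM p g)
      rw [h0]
      exact zero_mem _

theorem bidualHom_spec (F : ((M.contragredient hM).contragredient hM').carrier)
    (f : (M.contragredient hM).carrier) :
    contraVal hM f ((bidualHom hM hM').toLinearMap F) = contraVal hM' F f :=
  bidualFun_spec hM hM' F f

end

/-! ## Submodules -/

section

variable {W : PreModule.{w} 𝒱} {S : Submodule ℂ W.carrier} (hS : W.Stable S)

/-- The inclusion of a stable subspace. -/
def subVal : Hom (W.sub S hS) W where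
  toLinearMap := S.subtype
  map_Y _ _ _ := rfl
  map_L _ _ := rfl
  map_gr _ _ hx := hx

theorem subVal_injective : Function.Injective (subVal hS).toLinearMap := S.subtype_injective

theorem subVal_mem (x : (W.sub S hS).carrier) : (subVal hS).toLinearMap x ∈ S :=
  Subtype.property (p := (· ∈ S)) x

/-- A map into `W` with values in a stable subspace. -/
def subLift {M : PreModule.{w} 𝒱} (φ : Hom M W) (h : ∀ x, φ.toLinearMap x ∈ S) :
    Hom M (W.sub S hS) where
  toLinearMap := φ.toLinearMap.codRestrict S h
  map_Y v n x := subVal_injective hS (φ.map_Y v n x)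
  map_L j x := subVal_injective hS (φ.map_L j x)
  map_gr β x hx := φ.map_gr β x hx

end

/-! ## The intertwining map into the contragredient of a submodule of `(W₁ ⊗ W₂)^*` -/

section

variable {W₁ W₂ : PreModule.{w} 𝒱} (h₁ : W₁.IsGeneralizedModule) (h₂ : W₂.IsGeneralizedModule)
  {z : ℂ} {S : Submodule ℂ (qDual z h₁ h₂).carrier} (hS : (qDual z h₁ h₂).Stable S)
  (hB : ((qDual z h₁ h₂).sub S hS).IsGeneralizedModule)

/-- The evaluation at `t ∈ W₁ ⊗ W₂`. -/
def tensorEval : W₁.carrier ⊗[ℂ] W₂.carrier →ₗ[ℂ]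
    Module.Dual ℂ ((qDual z h₁ h₂).sub S hS).carrier :=
  (qEval h₁ h₂ z ∘ₗ (subVal hS).toLinearMap).flip

theorem tensorEval_of_gr {β γ δ : G} {w₁ : W₁.carrier} (hw₁ : w₁ ∈ W₁.gr β) {w₂ : W₂.carrier}
    (hw₂ : w₂ ∈ W₂.gr γ) {l : ((qDual z h₁ h₂).sub S hS).carrier}
    (hl : l ∈ ((qDual z h₁ h₂).sub S hS).gr δ) (h : β + γ ≠ -δ) :
    tensorEval h₁ h₂ hS (w₁ ⊗ₜ w₂) l = 0 :=
  (mem_qDual_gr h₁ h₂ z).1 hl _ h _ (tmul_mem_tensorGr hw₁ hw₂)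

/-- Evaluation at a homogeneous tensor is confined to one `G`-degree but possibly to no finite set
of weights; the weight projection confines it to a single homogeneous subspace. -/
theorem tensorEval_comp_mem (t : W₁.carrier ⊗[ℂ] W₂.carrier) (n : ℂ) :
    tensorEval h₁ h₂ hS t ∘ₗ wtProj hB n ∈ ((qDual z h₁ h₂).sub S hS).gradedDual := by
  refine tensor_induction h₁ h₂
    (P := fun t => tensorEval h₁ h₂ hS t ∘ₗ wtProj hB n ∈ ((qDual z h₁ h₂).sub S hS).gradedDual)
    (fun β γ w₁ hw₁ w₂ hw₂ => ?_) ?_ (fun s t h h' => ?_) t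
  · refine (Set.finite_singleton (-(β + γ), n)).subset ?_
    rintro ⟨δ, m⟩ ⟨l, hl, hne⟩
    rw [LinearMap.comp_apply] at hne
    refine Prod.ext ?_ ?_
    · by_contra hδ
      refine hne (tensorEval_of_gr h₁ h₂ hS hw₁ hw₂ (wtProj_mem_gr hB n hl.1) fun h => hδ ?_)
      change δ = -(β + γ)
      rw [h, neg_neg]
    · by_contra hm
      exact hne (by rw [wtProj_ne hB hl.2 (Ne.symm hm), map_zero])
  · rw [map_zero, LinearMap.zero_comp]
    exact zero_mem _
  · rw [map_add, LinearMap.add_comp]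
    exact add_mem h h'

/-- The map `I₀` with `⟨λ, I₀(w₁ ⊗ w₂)⟩ = λ(w₁ ⊗ w₂)`. -/
def evalIntertwining : W₁.carrier ⊗[ℂ] W₂.carrier →ₗ[ℂ]
    (((qDual z h₁ h₂).sub S hS).contragredient hB).completion where
  toFun t := ⟨fun n => contraMk hB _ (tensorEval_comp_mem h₁ h₂ hS hB t n),
    Submodule.mem_pi.2 fun n _ => mem_contra_wt hB fun m hm l hl => by
      rw [contraVal_mk, LinearMap.comp_apply, wtProj_ne hB hl hm.symm, map_zero]⟩
  map_add' s t := Subtype.ext <| funext fun n => contraVal_injective hB <| LinearMap.ext fun l =>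
    LinearMap.congr_fun (map_add (tensorEval h₁ h₂ hS) s t) (wtProj hB n l)
  map_smul' c t := Subtype.ext <| funext fun n => contraVal_injective hB <| LinearMap.ext fun l =>
    LinearMap.congr_fun (map_smul (tensorEval h₁ h₂ hS) c t) (wtProj hB n l)

theorem evalIntertwining_apply (t : W₁.carrier ⊗[ℂ] W₂.carrier) (n : ℂ)
    (l : ((qDual z h₁ h₂).sub S hS).carrier) :
    contraVal hB ((evalIntertwining h₁ h₂ hS hB t).1 n) l
      = qEval h₁ h₂ z ((subVal hS).toLinearMap (wtProj hB n l)) t := rfl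

/-- A tensor of degree `β + γ` pairs only with the part of degree `-(β + γ)`, whose weights are
truncated since the submodule is a generalized module. -/
theorem evalIntertwining_truncated (t : W₁.carrier ⊗[ℂ] W₂.carrier) (n : ℂ) :
    ∃ M : ℕ, ∀ m : ℕ, M ≤ m → (evalIntertwining h₁ h₂ hS hB t).1 (n - m) = 0 := by
  refine tensor_induction h₁ h₂ (P := fun t => ∃ M : ℕ, ∀ m : ℕ, M ≤ m →
    (evalIntertwining h₁ h₂ hS hB t).1 (n - m) = 0) (fun β γ w₁ hw₁ w₂ hw₂ => ?_)
    ⟨0, fun m _ => by rw [map_zero]; rfl⟩ (fun s t => ?_) t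
  · obtain ⟨M, hM⟩ := wtProj_truncated hB (-(β + γ)) n
    refine ⟨M, fun m hm => contraVal_injective hB <| LinearMap.ext fun l => ?_⟩
    rw [map_zero, LinearMap.zero_apply]
    refine dh_induction hB (P := fun l => contraVal hB
      ((evalIntertwining h₁ h₂ hS hB (w₁ ⊗ₜ w₂)).1 (n - m)) l = 0) (fun δ k l hl => ?_)
      (map_zero _) (fun x y h h' => by rw [map_add, h, h', add_zero]) l
    by_cases hδ : δ = -(β + γ)
    · rw [evalIntertwining_apply, hM m hm l (hδ ▸ hl.1), map_zero, map_zero, LinearMap.zero_apply]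
    · exact tensorEval_of_gr h₁ h₂ hS hw₁ hw₂ (wtProj_mem_gr hB _ hl.1) fun h => hδ <| by
        rw [h, neg_neg]
  · rintro ⟨M, hM⟩ ⟨N, hN⟩
    refine ⟨max M N, fun m hm => ?_⟩
    rw [map_add, Submodule.coe_add, Pi.add_apply, hM m (le_trans (le_max_left _ _) hm),
      hN m (le_trans (le_max_right _ _) hm), add_zero]

/-- Paired with `l`, the weight `k` component of the Jacobi identity is the compatibility condition
for `wtProj hB k l`. -/
theorem isQIntertwining_eval (hc : ∀ l, Compatible h₁ h₂ ((subVal hS).toLinearMap l)) :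
    IsQIntertwining z (evalIntertwining h₁ h₂ hS hB) := by
  refine ⟨fun β γ w₁ hw₁ w₂ hw₂ n => ?_,
    fun w₁ w₂ n => evalIntertwining_truncated h₁ h₂ hS hB _ n, fun h v hv w₁ w₂ m n k => ?_,
    fun j w₁ w₂ k => ?_⟩
  · rw [mem_contra_gr]
    intro δ hδ l hl
    exact tensorEval_of_gr h₁ h₂ hS hw₁ hw₂ (wtProj_mem_gr hB _ hl) fun h => hδ <| by
      rw [h, neg_neg]
  · have hfin := jacobiLeft_finite (evalIntertwining_truncated h₁ h₂ hS hB (w₁ ⊗ₜ w₂))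
      (fun i => (((qDual z h₁ h₂).sub S hS).contragredient hB).Yo v (m + i))
      (fun i => binom n i * z ^ (n - i)) m h k
    change _ = jacobiRight W₁ W₂ z ((((qDual z h₁ h₂).sub S hS).contragredient hB).completionProj k
      ∘ₗ evalIntertwining h₁ h₂ hS hB) v w₁ w₂ m n
    refine contraVal_injective hB <| LinearMap.ext fun l => ?_
    rw [← LinearMap.flip_apply (contraVal hB), ← LinearMap.flip_apply (contraVal hB),
      map_finsum _ hfin, map_jacobiRight h₁ h₂]
    have key := (hc (wtProj hB k l) h v hv w₁ w₂ m n).2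
    refine Eq.trans (finsum_congr fun i => ?_) key
    rw [map_smul, LinearMap.flip_apply, contra_Yo_apply, evalIntertwining_apply,
      ← (subVal hS).map_Y]
    -- The opposite operator on the contragredient is the transpose of `v_{m+i}`, which has weight
    -- `h - (m + i) - 1` and so carries one weight projection to the other.
    have e := wtProj_shift hB (fun c x hx => Y_wt hB hv (m + i) hx) k l
    have e' : k + ((h : ℂ) - ((m + i : ℤ) : ℂ) - 1) = k - ((m : ℂ) + i + 1 - h) := by
      push_cast; ring
    rw [e'] at e
    rw [e]
  · refine contraVal_injective hB <| LinearMap.ext fun l => ?_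
    rw [contra_L_apply, neg_neg, evalIntertwining_apply]
    have e := wtProj_shift hB (fun c x hx => L_wt hB j hx) k l
    rw [← sub_eq_add_neg] at e
    rw [e, (subVal hS).map_L, qDual_L_apply]
    simp only [map_sub, map_sum, map_smul, LinearMap.sub_apply, LinearMap.sum_apply,
      LinearMap.smul_apply, evalIntertwining_apply]

theorem pairing_eval (t : W₁.carrier ⊗[ℂ] W₂.carrier)
    (l : ((qDual z h₁ h₂).sub S hS).carrier) :
    bidualPairing hB l (evalIntertwining h₁ h₂ hS hB t)
      = qEval h₁ h₂ z ((subVal hS).toLinearMap l) t := by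
  have h := map_finsum (tensorEval h₁ h₂ hS t) (decompProj_finite
    (wt_indep ((qDual z h₁ h₂).sub S hS)) hB.weight_top l)
  rw [finsum_decompProj] at h
  exact h.symm

end

/-! ## The universal property -/

section

variable {W₁ W₂ W : PreModule.{w} 𝒱} (h₁ : W₁.IsGeneralizedModule) (h₂ : W₂.IsGeneralizedModule)
  {z : ℂ} {S : Submodule ℂ (qDual z h₁ h₂).carrier} (hS : (qDual z h₁ h₂).Stable S)
  (hB : ((qDual z h₁ h₂).sub S hS).IsGeneralizedModule)
  (hW : W.IsGeneralizedModule)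

/-- A map out of the contragredient is determined by its values on the components of `I₀`. -/
theorem hom_ext_of_eval (hW : W.IsGeneralizedModule)
    (hB' : (((qDual z h₁ h₂).sub S hS).contragredient hB).IsGeneralizedModule)
    {η η' : Hom (((qDual z h₁ h₂).sub S hS).contragredient hB) W}
    (h : ∀ t n, η.toLinearMap ((evalIntertwining h₁ h₂ hS hB t).1 n)
      = η'.toLinearMap ((evalIntertwining h₁ h₂ hS hB t).1 n)) : η = η' := by
  refine Hom.ext (LinearMap.ext fun f => eq_of_homDual hW fun p g => ?_)
  -- The transpose of `ζ` sends the functional into the bidual, which is identified with the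
  -- submodule itself.
  have key : ∀ ζ : Hom (((qDual z h₁ h₂).sub S hS).contragredient hB) W,
      ∃ l, ∀ f, contraVal hW (homDual hW p g) (ζ.toLinearMap f) = contraVal hB f l :=
    fun ζ => ⟨_, fun f => (bidualHom_spec hB hB'
      ((ζ.transpose hB' hW).toLinearMap (homDual hW p g)) f).symm⟩
  obtain ⟨l, hl⟩ := key η
  obtain ⟨l', hl'⟩ := key η'
  have e : l = l' := by
    -- `l` and `l'` are functionals on `W₁ ⊗ W₂`; agreement of `η` and `η'` on components of `I₀` is
    -- agreement of their weight components on all tensors.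
    have hn : ∀ n, wtProj hB n l = wtProj hB n l' := fun n => by
      refine subVal_injective hS (qEval_ext h₁ h₂ z fun w₁ w₂ => ?_)
      rw [← evalIntertwining_apply, ← evalIntertwining_apply, ← hl, ← hl', h]
    have e := finsum_congr hn
    simp only [wtProj, finsum_decompProj] at e
    exact e
  rw [hl, hl', e]

/-- The map that corresponds to a `Q(z)`-product. -/
theorem lift_eval (hW' : (W.contragredient hW).IsGeneralizedModule)
    {I : W₁.carrier ⊗[ℂ] W₂.carrier →ₗ[ℂ] W.completion} (hI : IsQIntertwining z I)
    (h : ∀ f, dualMap h₁ h₂ hW hI f ∈ S) (t : W₁.carrier ⊗[ℂ] W₂.carrier) (n : ℂ) :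
    (I t).1 n = ((bidualHom hW hW').comp ((subLift hS (dualHom h₁ h₂ hW hI) h).transpose
      hW' hB)).toLinearMap ((evalIntertwining h₁ h₂ hS hB t).1 n) := by
  refine eq_of_homDual hW fun p g => ?_
  have hf := fun n (hn : n ≠ p.2) x hx => homDual_apply_of_ne hW hn g (x := x) hx
  refine Eq.trans ?_ (bidualHom_spec hW hW' _ _).symm
  rw [Hom.transpose_apply, evalIntertwining_apply]
  -- Maps preserve weights, so both sides vanish unless `n = p.2`.
  have hwt := (subLift hS (dualHom h₁ h₂ hW hI) h).map_wt (homDual_mem_wt hW p g)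
  by_cases hn : n = p.2
  · subst hn
    rw [wtProj_same hB hwt]
    exact (dualMap_of_wt h₁ h₂ hW hI hf t).symm
  · rw [wtProj_ne hB hwt hn, map_zero, map_zero, LinearMap.zero_apply]
    exact hf n hn _ (completion_mem _ n)

end

/-! ## Quotients of generalized modules -/

section

theorem decompProj_map {ι P Q : Type*} [AddCommGroup P] [Module ℂ P] [AddCommGroup Q] [Module ℂ Q]
    {D : ι → Submodule ℂ P} {E : ι → Submodule ℂ Q} (hi : iSupIndep D) (ht : ⨆ i, D i = ⊤)
    (hi' : iSupIndep E) (ht' : ⨆ i, E i = ⊤) (φ : P →ₗ[ℂ] Q) (h : ∀ i, ∀ x ∈ D i, φ x ∈ E i)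
    (i : ι) (x : P) : decompProj hi' ht' i (φ x) = φ (decompProj hi ht i x) := by
  have hx : x ∈ ⨆ i, D i := by rw [ht]; trivial
  refine Submodule.iSup_induction D
    (motive := fun x => decompProj hi' ht' i (φ x) = φ (decompProj hi ht i x)) hx
    (fun j y hy => ?_) (by simp) fun y y' h h' => by simp only [map_add, h, h']
  by_cases hij : i = j
  · subst hij
    rw [decompProj_same _ _ hy, decompProj_same _ _ (h i y hy)]
  · rw [decompProj_ne _ _ hy hij, decompProj_ne _ _ (h j y hy) hij, map_zero]

theorem iSup_eq_top_of_surjective {ι P Q : Type*} [AddCommGroup P] [Module ℂ P] [AddCommGroup Q]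
    [Module ℂ Q] {D : ι → Submodule ℂ P} {E : ι → Submodule ℂ Q} (ht : ⨆ i, D i = ⊤)
    {φ : P →ₗ[ℂ] Q} (hφ : Function.Surjective φ) (h : ∀ i, ∀ x ∈ D i, φ x ∈ E i) :
    ⨆ i, E i = ⊤ := by
  rw [eq_top_iff, ← LinearMap.range_eq_top.2 hφ, LinearMap.range_eq_map, ← ht, Submodule.map_iSup]
  exact iSup_mono fun i => Submodule.map_le_iff_le_comap.2 (h i)

variable {M N : PreModule.{w} 𝒱}

/-- Homogeneous vectors lift to homogeneous ones: `φ` commutes with the projections onto degrees and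
weights, so any preimage may be projected. -/
theorem Hom.exists_dh (φ : Hom M N) (hM : M.IsGeneralizedModule)
    (hφ : Function.Surjective φ.toLinearMap) (hgr : iSupIndep N.gr) {β : G} {y : N.carrier}
    (hy : y ∈ N.gr β) : ∃ x ∈ M.gr β, φ.toLinearMap x = y ∧
      ∀ n, y ∈ N.wt n → φ.toLinearMap (wtProj hM n x) = y := by
  obtain ⟨x, rfl⟩ := hφ y
  have h := decompProj_map hM.gr_indep hM.gr_top hgr
    (iSup_eq_top_of_surjective hM.gr_top hφ φ.map_gr) φ.toLinearMap φ.map_gr β x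
  rw [decompProj_same _ _ hy] at h
  refine ⟨_, decompProj_mem hM.gr_indep hM.gr_top β x, h.symm, fun n hn => ?_⟩
  have h' := decompProj_map M.wt_indep hM.weight_top N.wt_indep
    (iSup_eq_top_of_surjective hM.weight_top hφ fun n x => φ.map_wt) φ.toLinearMap
    (fun n x => φ.map_wt) n (decompProj hM.gr_indep hM.gr_top β x)
  rw [← h, decompProj_same _ _ hn] at h'
  exact h'.symm

/-- A quotient of a generalized module whose grading subspaces are independent is a generalized
module. -/
theorem isGeneralizedModule_of_surjective (φ : Hom M N) (hM : M.IsGeneralizedModule)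
    (hφ : Function.Surjective φ.toLinearMap) (hgr : iSupIndep N.gr) : N.IsGeneralizedModule where
  lowerTruncated v y := by
    obtain ⟨x, rfl⟩ := hφ y
    obtain ⟨K, hK⟩ := hM.lowerTruncated v x
    exact ⟨K, fun n hn => by rw [← φ.map_Y, hK n hn, map_zero]⟩
  vacuum n := LinearMap.ext fun y => by
    obtain ⟨x, rfl⟩ := hφ y
    rw [← φ.map_Y, hM.vacuum]
    split_ifs
    · rfl
    · simp
  jacobi a b y l m n := by
    obtain ⟨x, rfl⟩ := hφ y
    have h := congrArg φ.toLinearMap (hM.jacobi a b x l m n)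
    -- Passing `φ` through the sums needs finite supports, supplied by truncation in `V` on the
    -- right and in `M` on the left.
    rw [map_finsum, map_finsum] at h
    · simpa only [map_smul, map_sub, φ.map_Y] using h
    · obtain ⟨K, hK⟩ := 𝒱.lowerTruncated a b
      refine (Set.finite_Iio (K - l).toNat).subset fun i hi => ?_
      by_contra hni
      simp only [Set.mem_Iio, not_lt] at hni
      refine hi ?_
      simp only
      rw [hK _ (by omega), map_zero, Pi.zero_apply, LinearMap.zero_apply, smul_zero]
    · obtain ⟨K, hK⟩ := hM.lowerTruncated b x
      obtain ⟨K', hK'⟩ := hM.lowerTruncated a x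
      refine (Set.finite_Iio (max (K - n).toNat (K' - m).toNat)).subset fun i hi => ?_
      by_contra hni
      simp only [Set.mem_Iio, not_lt, max_le_iff] at hni
      refine hi ?_
      simp only
      rw [hK _ (by omega), hK' _ (by omega), map_zero, map_zero, smul_zero, sub_zero, smul_zero]
  sl2 := by
    obtain ⟨e₁, e₂, e₃⟩ := hM.sl2
    refine ⟨LinearMap.ext fun y => ?_, LinearMap.ext fun y => ?_, LinearMap.ext fun y => ?_⟩ <;>
      obtain ⟨x, rfl⟩ := hφ y
    · have h := congrArg φ.toLinearMap (LinearMap.congr_fun e₁ x)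
      simpa only [Ring.lie_def, LinearMap.sub_apply, Module.End.mul_apply, map_sub, φ.map_L] using h
    · have h := congrArg φ.toLinearMap (LinearMap.congr_fun e₂ x)
      simpa only [Ring.lie_def, LinearMap.sub_apply, Module.End.mul_apply, map_sub, φ.map_L,
        LinearMap.neg_apply, map_neg] using h
    · have h := congrArg φ.toLinearMap (LinearMap.congr_fun e₃ x)
      simpa only [Ring.lie_def, LinearMap.sub_apply, Module.End.mul_apply, map_sub, φ.map_L,
        LinearMap.smul_apply, map_smul] using h
  sl2_bracket j v n := LinearMap.ext fun y => by
    obtain ⟨x, rfl⟩ := hφ y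
    have h := congrArg φ.toLinearMap (LinearMap.congr_fun (hM.sl2_bracket j v n) x)
    simpa only [Ring.lie_def, LinearMap.sub_apply, Module.End.mul_apply, map_sub, φ.map_L,
      φ.map_Y, LinearMap.sum_apply, map_sum, LinearMap.smul_apply, map_smul] using h
  derivative v n := LinearMap.ext fun y => by
    obtain ⟨x, rfl⟩ := hφ y
    have h := congrArg φ.toLinearMap (LinearMap.congr_fun (hM.derivative v n) x)
    simpa only [φ.map_Y, LinearMap.smul_apply, map_smul] using h
  conformal ω c hc := by
    obtain ⟨e₁, e₂⟩ := hM.conformal ω c hc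
    refine ⟨fun m n => LinearMap.ext fun y => ?_, fun j => LinearMap.ext fun y => ?_⟩ <;>
      obtain ⟨x, rfl⟩ := hφ y
    · have h := congrArg φ.toLinearMap (LinearMap.congr_fun (e₁ m n) x)
      split_ifs at h ⊢ <;>
      simpa only [Ring.lie_def, LinearMap.sub_apply, Module.End.mul_apply, map_sub, map_add,
        LinearMap.add_apply, φ.map_Y, LinearMap.smul_apply, map_smul, Module.End.one_apply,
        LinearMap.zero_apply, map_zero] using h
    · rw [← φ.map_L, ← φ.map_Y, e₂]
  weight_top := iSup_eq_top_of_surjective hM.weight_top hφ fun n x => φ.map_wt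
  gr_indep := hgr
  gr_top := iSup_eq_top_of_surjective hM.gr_top hφ φ.map_gr
  gr_compatible β := by
    refine le_antisymm (fun y hy => ?_) (iSup_le fun n => inf_le_left)
    obtain ⟨x, hx, rfl, -⟩ := φ.exists_dh hM hφ hgr hy
    rw [hM.gr_compatible] at hx
    have h := Submodule.mem_map_of_mem (f := φ.toLinearMap) hx
    rw [Submodule.map_iSup] at h
    refine (show _ ≤ ⨆ n, N.gr β ⊓ N.wt n from iSup_mono fun n => ?_) h
    rintro _ ⟨x, hx, rfl⟩
    exact ⟨φ.map_gr β x hx.1, φ.map_wt hx.2⟩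
  gr_truncated β n := by
    obtain ⟨K, hK⟩ := hM.gr_truncated β n
    refine ⟨K, fun k hk => (Submodule.eq_bot_iff _).2 fun y hy => ?_⟩
    obtain ⟨x, hx, -, h⟩ := φ.exists_dh hM hφ hgr hy.1
    have h0 : wtProj hM (n + k) x ∈ M.gr β ⊓ M.wt (n + k) :=
      ⟨wtProj_mem_gr hM _ hx, wtProj_mem hM _ _⟩
    rw [hK k hk, Submodule.mem_bot] at h0
    rw [← h _ hy.2, h0, map_zero]
  gr_finite β n := by
    have := hM.gr_finite β n
    refine Submodule.finiteDimensional_of_le (S₂ := (M.gr β ⊓ M.wt n).map φ.toLinearMap) ?_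
    intro y hy
    obtain ⟨x, hx, -, h⟩ := φ.exists_dh hM hφ hgr hy.1
    exact ⟨wtProj hM n x, ⟨wtProj_mem_gr hM _ hx, wtProj_mem hM _ _⟩, h n hy.2⟩
  Y_mem α β v hv y hy n := by
    obtain ⟨x, hx, rfl, -⟩ := φ.exists_dh hM hφ hgr hy
    rw [← φ.map_Y]
    exact φ.map_gr _ _ (hM.Y_mem α β v hv x hx n)
  L_mem j β y hy := by
    obtain ⟨x, hx, rfl, -⟩ := φ.exists_dh hM hφ hgr hy
    rw [← φ.map_L]
    exact φ.map_gr _ _ (hM.L_mem j β x hx)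

theorem image_isomorphic (φ : Hom M N) (hφ : Function.Surjective φ.toLinearMap) :
    Isomorphic (image φ) N :=
  ⟨subVal (stable_range φ),
    { toLinearMap := LinearMap.codRestrict (LinearMap.range φ.toLinearMap) LinearMap.id hφ
      map_Y := fun _ _ _ => rfl
      map_L := fun _ _ => rfl
      map_gr := fun _ _ hx => hx }, fun _ => rfl, fun _ => rfl⟩

theorem sub_gr_indep {S : Submodule ℂ M.carrier} (hS : M.Stable S) (h : iSupIndep M.gr) :
    iSupIndep (M.sub S hS).gr := by
  classical
  rw [iSupIndep_iff_finsetSum_eq_zero_imp_eq_zero] at h ⊢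
  intro s x hx hsum i hi
  refine subVal_injective hS ?_
  rw [map_zero]
  exact h s (fun i => (subVal hS).toLinearMap (x i)) hx
    (by rw [← map_sum, hsum, map_zero]) i hi

end

end PreModule

/-! ## The main result -/

section

open PreModule

variable (𝒞 : ModuleCategory.{w} 𝒱) (z : ℂ) {W₁ W₂ : PreModule.{w} 𝒱} (h₁ : 𝒞.Obj W₁)
  (h₂ : 𝒞.Obj W₂) (hS : (qDual z (𝒞.isModule h₁) (𝒞.isModule h₂)).Stable (box 𝒞 z W₁ W₂))

theorem isQTensorProduct_box (hobj : 𝒞.Obj (boxModule 𝒞 z h₁ h₂ hS)) :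
    IsQTensorProduct 𝒞 z
      (evalIntertwining (𝒞.isModule h₁) (𝒞.isModule h₂) hS (𝒞.isModule hobj)) := by
  refine ⟨𝒞.contragredient hobj, isQIntertwining_eval _ _ hS _ fun l =>
    box_compatible 𝒞 z h₁ h₂ (subVal_mem hS l), fun W hW I hI => ?_⟩
  have key := lift_eval _ _ hS (𝒞.isModule hobj) (𝒞.isModule hW)
    (𝒞.isModule (𝒞.contragredient hW)) hI
    fun f => (mem_box_iff 𝒞 z h₁ h₂).2 ⟨W, hW, I, hI, f, rfl⟩
  refine ⟨_, key, fun η hη => ?_⟩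
  exact hom_ext_of_eval _ _ hS _ (𝒞.isModule hW) (𝒞.isModule (𝒞.contragredient hobj))
    fun t n => (hη t n).symm.trans (key t n)

theorem obj_boxModule (him : 𝒞.ClosedUnderImages) {W₀ : PreModule.{w} 𝒱}
    {I₀ : W₁.carrier ⊗[ℂ] W₂.carrier →ₗ[ℂ] W₀.completion} (h₀ : IsQTensorProduct 𝒞 z I₀) :
    𝒞.Obj (boxModule 𝒞 z h₁ h₂ hS) := by
  obtain ⟨hW₀, hI₀, huniv⟩ := h₀
  let φ : Hom (W₀.contragredient (𝒞.isModule hW₀)) (boxModule 𝒞 z h₁ h₂ hS) :=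
    subLift hS (dualHom (𝒞.isModule h₁) (𝒞.isModule h₂) (𝒞.isModule hW₀) hI₀) fun f =>
      (mem_box_iff 𝒞 z h₁ h₂).2 ⟨W₀, hW₀, I₀, hI₀, f, rfl⟩
  -- If `l = I'(f)` and `I` factors through `I₀` by `η`, then `l = I₀'(η' f)`.
  have hφ : Function.Surjective φ.toLinearMap := by
    intro l
    obtain ⟨W, hW, I, hI, f, hf⟩ := (mem_box_iff 𝒞 z h₁ h₂).1 (subVal_mem hS l)
    obtain ⟨η, hη, -⟩ := huniv W hW I hI
    refine ⟨(η.transpose (𝒞.isModule hW₀) (𝒞.isModule hW)).toLinearMap f, subVal_injective hS ?_⟩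
    refine Eq.trans (LinearMap.ext fun t => ?_) hf.symm
    exact finsum_congr fun n => congrArg (contraVal (𝒞.isModule hW) f) (hη t n).symm
  -- Closure under images requires the target to be a generalized module already, which surjectivity
  -- of `φ` provides.
  have hB := isGeneralizedModule_of_surjective φ (𝒞.isModule (𝒞.contragredient hW₀)) hφ
    (sub_gr_indep hS (qDual_gr_indep (𝒞.isModule h₁) (𝒞.isModule h₂) z))
  exact 𝒞.iso (image_isomorphic φ hφ) (him _ _ (𝒞.contragredient hW₀) hB φ)

end

end VTC

end

theorem mainTheorem12 {G : Type*} [AddCommGroup G] {A : AddSubgroup G}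
    {V : Type*} [AddCommGroup V] [Module ℂ V] (𝒱 : VTC.StronglyGradedVertexAlgebra A V)
    (𝒞 : VTC.ModuleCategory 𝒱) (z : ℂ) (hz : z ≠ 0)
    (W₁ W₂ : VTC.PreModule 𝒱) (h₁ : 𝒞.Obj W₁) (h₂ : 𝒞.Obj W₂) :
    -- the union of the images is a linear subspace
    ((VTC.box 𝒞 z W₁ W₂ : Set (Module.Dual ℂ (W₁.carrier ⊗[ℂ] W₂.carrier))) =
      VTC.boxSet 𝒞 z W₁ W₂) ∧
    -- if the subspace is an object, its contragredient is the tensor product, the intertwining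
    -- map being the one that corresponds to the inclusion of the subspace in the dual space
    (∀ (hS : (VTC.PreModule.qDual z (𝒞.isModule h₁) (𝒞.isModule h₂)).Stable (VTC.box 𝒞 z W₁ W₂))
      (hobj : 𝒞.Obj (VTC.boxModule 𝒞 z h₁ h₂ hS)),
      ∃ I₀ : W₁.carrier ⊗[ℂ] W₂.carrier →ₗ[ℂ]
          ((VTC.boxModule 𝒞 z h₁ h₂ hS).contragredient (𝒞.isModule hobj)).completion,
        (∀ (l : VTC.box 𝒞 z W₁ W₂) (t : W₁.carrier ⊗[ℂ] W₂.carrier),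
          VTC.bidualPairing (𝒞.isModule hobj) l (I₀ t) = l.1 t) ∧
        VTC.IsQTensorProduct 𝒞 z I₀) ∧
    -- the converse
    (𝒞.ClosedUnderImages →
      (∃ (W₀ : VTC.PreModule 𝒱) (I₀ : W₁.carrier ⊗[ℂ] W₂.carrier →ₗ[ℂ] W₀.completion),
        VTC.IsQTensorProduct 𝒞 z I₀) →
      ∃ hS : (VTC.PreModule.qDual z (𝒞.isModule h₁) (𝒞.isModule h₂)).Stable (VTC.box 𝒞 z W₁ W₂),
        𝒞.Obj (VTC.boxModule 𝒞 z h₁ h₂ hS)) := by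
  exact ⟨VTC.box_eq_boxSet 𝒞 z h₁ h₂,
    fun hS hobj => ⟨_, fun l t => VTC.PreModule.pairing_eval _ _ hS (𝒞.isModule hobj) t l,
      VTC.isQTensorProduct_box 𝒞 z h₁ h₂ hS hobj⟩,
    fun him ⟨_, _, h₀⟩ => ⟨VTC.box_stable 𝒞 z h₁ h₂,
      VTC.obj_boxModule 𝒞 z h₁ h₂ (VTC.box_stable 𝒞 z h₁ h₂) him h₀⟩⟩
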